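/- **Setting.** Let $X,Z$ be topological spaces. All covers are finite indexed families. A *map of covers* $\{U_\alpha\}_{\alpha\in A}\to\{V_\beta\}_{\beta\in B}$ of the same space is a map $\xi:A\to B$ with $U_\alpha\subseteq V_{\xi(\alpha)}$ for all $\alpha$. A *tower* of resolution $r\in\mathbb R$ is a collection of objects $\{\mathcal W_\varepsilon\}_{\varepsilon\ge r}$ with maps $w_{\varepsilon,\varepsilon'}:\mathcal W_\varepsilon\to\mathcal W_{\varepsilon'}$ for $r\le\varepsilon\le\varepsilon'$ such that $w_{\varepsilon,\varepsilon}=\mathrm{id}$ and $w_{\varepsilon',\varepsilon''}\circ w_{\varepsilon,\varepsilon'}=w_{\varepsilon,\varepsilon''}$. A *tower of covers* of $Z$ is a tower of finite open covers of $Z$ by path connected sets, with maps of covers; a *tower of simplicial complexes* is a tower of finite simplicial complexes with simplicial maps. A continuous map $f:X\to Z$ is *well-behaved* if $f^{-1}(U)$ has finitely many path components for every path connected open $U\subseteq Z$. The pullback $f^*(\mathcal U)$ of a cover $\mathcal U$ of $Z$ is the cover of $X$ by the path components of the sets $f^{-1}(U_\alpha)$, and a map of covers $\xi$ induces the map sending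 a path component of $f^{-1}(U_\alpha)$ to the path component of $f^{-1}(V_{\xi(\alpha)})$ containing it. The *multiscale mapper* of a tower of covers $\mathfrak U$ of $Z$ is the tower of simplicial complexes $\mathrm{MM}(\mathfrak U,f)=N(f^*(\mathfrak U))$, where $N$ is the nerve. Two towers of covers $\mathfrak U,\mathfrak V$ of the same resolution $r$ are *$\eta$-interleaved* ($\eta\ge0$) if there are maps of covers $\mathcal U_\varepsilon\to\mathcal V_{\varepsilon+\eta}$ and $\mathcal V_\varepsilon\to\mathcal U_{\varepsilon+\eta}$ for all $\varepsilon\ge r$. Simplicial maps $g,h:K\to L$ are *contiguous* if $g(\sigma)\cup h(\sigma)\in L$ for all $\sigma\in K$. Two towers of simplicial complexes $(\mathcal S_\varepsilon,s)$, $(\mathcal T_\varepsilon,t)$ of the same resolution $r$ are *$\eta$-interleaved* if there are simplicial maps $\varphi_\varepsilon:\mathcal S_\varepsilon\to\mathcal T_{\varepsilon+\eta}$ and $\psi_\varepsilon:\mathcal T_\varepsilon\to\mathcal S_{\varepsilon+\eta}$ for all $\varepsilon\ge r$ such that, for all $\varepsilon'\ge\varepsilon\ge r$, the following pairs are contiguous: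 $\psi_{\varepsilon+\eta}\circ\varphi_\varepsilon$ and $s_{\varepsilon,\varepsilon+2\eta}$; $\varphi_{\varepsilon+\eta}\circ\psi_\varepsilon$ and $t_{\varepsilon,\varepsilon+2\eta}$; $\varphi_{\varepsilon'}\circ s_{\varepsilon,\varepsilon'}$ and $t_{\varepsilon+\eta,\varepsilon'+\eta}\circ\varphi_\varepsilon$; $s_{\varepsilon+\eta,\varepsilon'+\eta}\circ\psi_\varepsilon$ and $\psi_{\varepsilon'}\circ t_{\varepsilon,\varepsilon'}$. Fix a field $\mathbb K$. For a tower of simplicial complexes $\mathfrak S$, $\mathrm D_k\mathfrak S$ is the persistence diagram of the persistence module $\varepsilon\mapsto H_k(\mathcal S_\varepsilon;\mathbb K)$, extended by $0$ to $\varepsilon<r$: the multiset of points (birth, death) $\in\mathbb R\times(\mathbb R\cup\{\infty\})$ with birth $<$ death whose multiplicities are determined by the ranks of the maps of the module. The bottleneck distance of two diagrams is the infimum of the $\delta\ge0$ for which there is a partial matching of their points such that matched points are at $\ell^\infty$-distance at most $\delta$ and unmatched points are at $\ell^\infty$-distance at most $\delta$ from the diagonal. **Statement.** Let $\eta\ge0$,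 let $f:X\to Z$ be continuous and well-behaved, and let $\mathfrak U$, $\mathfrak V$ be two $\eta$-interleaved towers of covers of $Z$ of the same resolution $r>0$. Then $\mathrm{MM}(\mathfrak U,f)$ and $\mathrm{MM}(\mathfrak V,f)$ are $\eta$-interleaved. In particular, for every $k\in\mathbb N$, the bottleneck distance between $\mathrm D_k\mathrm{MM}(\mathfrak U,f)$ and $\mathrm D_k\mathrm{MM}(\mathfrak V,f)$ is at most $\eta$. -/

import Mathlib

open CategoryTheory
open scoped NNReal ENNReal

/-! ### Covers -/

/-- A finite cover of a space `X`: a finite indexed family of subsets whose union is `X`. -/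
structure Cover.{w, u} (X : Type u) where
  /-- the index set -/
  ι : Type w
  finite : Finite ι
  /-- the members of the cover -/
  set : ι → Set X
  iUnion_set : ⋃ i, set i = Set.univ

/-- A finite open cover, all of whose members are path connected. -/
structure OpenCover.{w, u} (Z : Type u) [TopologicalSpace Z] extends Cover.{w, u} Z where
  isOpen : ∀ i, IsOpen (set i)
  isPathConnected : ∀ i, IsPathConnected (set i)

/-- A map of covers `𝒰 → 𝒱`: a map `φ` of index sets with `U i ⊆ V (φ i)` for all `i`. -/
@[ext]
structure CoverMap.{w, w', u} {X : Type u} (U : Cover.{w, u} X) (V : Cover.{w', u} X) where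
  toFun : U.ι → V.ι
  subset : ∀ i, U.set i ⊆ V.set (toFun i)

namespace CoverMap

/-- The identity map of covers. -/
@[simps]
def id {X : Type*} (U : Cover X) : CoverMap U U where
  toFun i := i
  subset _ := subset_rfl

/-- Composition of maps of covers. -/
@[simps]
def comp {X : Type*} {U V W : Cover X} (φ : CoverMap U V) (ψ : CoverMap V W) :
    CoverMap U W where
  toFun i := ψ.toFun (φ.toFun i)
  subset i := (φ.subset i).trans (ψ.subset _)

end CoverMap

instance Cover.category.{w, u} (X : Type u) : Category.{w} (Cover.{w, u} X) where
  Hom U V := CoverMap U V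
  id U := CoverMap.id U
  comp φ ψ := φ.comp ψ

instance OpenCover.category.{w, u} (Z : Type u) [TopologicalSpace Z] :
    Category.{w} (OpenCover.{w, u} Z) where
  Hom U V := CoverMap U.toCover V.toCover
  id U := CoverMap.id U.toCover
  comp φ ψ := φ.comp ψ

/-- `f : X → Z` is well-behaved if the preimage of every path connected open set has finitely many
path components. -/
def WellBehaved {X Z : Type*} [TopologicalSpace X] [TopologicalSpace Z] (f : X → Z) : Prop :=
  ∀ U : Set Z, IsOpen U → IsPathConnected U → Finite (ZerothHomotopy (f ⁻¹' U))

/-- The subset of `X` underlying a path component of a subspace `A` of `X`. -/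
def pathComponentSet {X : Type*} [TopologicalSpace X] {A : Set X} (c : ZerothHomotopy A) : Set X :=
  Subtype.val '' (ZerothHomotopy.mk ⁻¹' {c})

/-- The map on path components induced by an inclusion of subspaces. -/
def pathComponentMap {X : Type*} [TopologicalSpace X] {A B : Set X} (h : A ⊆ B) :
    ZerothHomotopy A → ZerothHomotopy B :=
  ZerothHomotopy.lift (fun x => ZerothHomotopy.mk (Set.inclusion h x))
    fun _ _ γ => ZerothHomotopy.sound (γ.map (continuous_inclusion h))

/-- The pullback cover `f*(𝒰)`: its members are the path components of the sets `f⁻¹(U i)`. -/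
def OpenCover.pullback.{w, v, u} {X : Type u} {Z : Type v} [TopologicalSpace X]
    [TopologicalSpace Z] (f : C(X, Z)) (hf : WellBehaved f) (U : OpenCover.{w, v} Z) :
    Cover.{max w u, u} X where
  ι := Σ i : U.ι, ZerothHomotopy (f ⁻¹' U.set i)
  finite := by
    have := U.finite
    have := fun i => hf (U.set i) (U.isOpen i) (U.isPathConnected i)
    infer_instance
  set p := pathComponentSet p.2
  iUnion_set := by
    refine Set.eq_univ_of_forall fun x => ?_
    have hx : f x ∈ ⋃ i, U.set i := U.iUnion_set ▸ Set.mem_univ _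
    obtain ⟨i, hi⟩ := Set.mem_iUnion.1 hx
    exact Set.mem_iUnion.2 ⟨⟨i, ZerothHomotopy.mk ⟨x, hi⟩⟩, ⟨x, hi⟩, rfl, rfl⟩

/-- The pullback as a functor: a map of covers `φ` sends the path component `c` of `f⁻¹(U i)` to
the path component of `f⁻¹(V (φ i))` that contains it. -/
def pullbackFunctor.{w, v, u} {X : Type u} {Z : Type v} [TopologicalSpace X]
    [TopologicalSpace Z] (f : C(X, Z)) (hf : WellBehaved f) :
    OpenCover.{w, v} Z ⥤ Cover.{max w u, u} X where
  obj U := U.pullback f hf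
  map {U V} φ :=
    { toFun := fun p => ⟨φ.toFun p.1, pathComponentMap (Set.preimage_mono (φ.subset p.1)) p.2⟩
      subset := by
        rintro ⟨i, c⟩ _ ⟨x, hx, rfl⟩
        exact ⟨Set.inclusion (Set.preimage_mono (φ.subset i)) x,
          congrArg (pathComponentMap (Set.preimage_mono (φ.subset i))) hx, rfl⟩ }
  map_id U := by
    refine CoverMap.ext (funext ?_)
    rintro ⟨i, c⟩
    induction c with
    | mk x => rfl
  map_comp {U V W} φ ψ := by
    refine CoverMap.ext (funext ?_)
    rintro ⟨i, c⟩
    induction c with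
    | mk x => rfl

/-! ### Simplicial complexes -/

/-- A finite abstract simplicial complex over a finite vertex set. -/
structure FinComplex.{w} where
  /-- the vertex set -/
  V : Type w
  finite : Finite V
  /-- the simplices -/
  complex : PreAbstractSimplicialComplex V

/-- A simplicial map: a map of vertex sets that sends simplices to simplices. -/
@[ext]
structure SimplicialMap.{w, w'} (K : FinComplex.{w}) (L : FinComplex.{w'}) where
  toFun : K.V → L.V
  image_mem : open scoped Classical in ∀ σ ∈ K.complex.faces, σ.image toFun ∈ L.complex.faces

namespace SimplicialMap

/-- The identity simplicial map. -/
@[simps]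
def id (K : FinComplex) : SimplicialMap K K where
  toFun v := v
  image_mem σ hσ := by simpa using hσ

/-- Composition of simplicial maps. -/
@[simps]
def comp {K L M : FinComplex} (f : SimplicialMap K L) (g : SimplicialMap L M) :
    SimplicialMap K M where
  toFun v := g.toFun (f.toFun v)
  image_mem σ hσ := by
    classical
    have h := g.image_mem _ (f.image_mem σ hσ)
    rw [Finset.image_image] at h
    exact h

/-- Two simplicial maps `f, g : K → L` are contiguous if `f(σ) ∪ g(σ)` is a simplex of `L` for
every simplex `σ` of `K`. -/
def Contiguous {K L : FinComplex} (f g : SimplicialMap K L) : Prop :=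
  open scoped Classical in
  ∀ σ ∈ K.complex.faces, σ.image f.toFun ∪ σ.image g.toFun ∈ L.complex.faces

end SimplicialMap

instance FinComplex.category.{w} : Category.{w} FinComplex.{w} where
  Hom K L := SimplicialMap K L
  id K := SimplicialMap.id K
  comp f g := f.comp g

/-- The nerve of a cover: the vertices are the indices, and a non-empty set of indices is a
simplex if the corresponding members of the cover have a common point. -/
def Cover.nerve.{w, u} {X : Type u} (U : Cover.{w, u} X) : FinComplex.{w} where
  V := U.ι
  finite := U.finite
  complex :=
    { faces := {σ | σ.Nonempty ∧ (⋂ i ∈ σ, U.set i).Nonempty}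
      isRelLowerSet_faces := fun _ h =>
        ⟨h.1, fun _ hts ht => ⟨ht, h.2.mono (Set.biInter_subset_biInter_left hts)⟩⟩ }

/-- The nerve as a functor: a map of covers induces a simplicial map of nerves. -/
def nerveFunctor.{w, u} (X : Type u) : Cover.{w, u} X ⥤ FinComplex.{w} where
  obj U := U.nerve
  map {U V} φ :=
    { toFun := φ.toFun
      image_mem := by
        classical
        rintro σ ⟨hσ, x, hx⟩
        refine ⟨hσ.image _, x, ?_⟩
        simp only [Set.mem_iInter] at hx ⊢
        intro j hj
        obtain ⟨i, hi, rfl⟩ := Finset.mem_image.1 hj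
        exact φ.subset i (hx i hi) }

/-! ### Towers and interleavings -/

/-- A tower with resolution `r` of objects of `C`: objects `W ε` for the reals `ε ≥ r`, and maps
`W ε → W ε'` for `ε ≤ ε'`, compatible with identities and composition. -/
abbrev Tower.{v, u} (r : ℝ) (C : Type u) [Category.{v} C] := Set.Ici r ⥤ C

/-- The scale `ε + η`. -/
def shift {r : ℝ} (η : ℝ≥0) (ε : Set.Ici r) : Set.Ici r :=
  ⟨ε + η, le_add_of_le_of_nonneg ε.2 η.2⟩

lemma le_shift {r : ℝ} (η : ℝ≥0) (ε : Set.Ici r) : ε ≤ shift η ε :=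
  Subtype.coe_le_coe.1 (le_add_of_nonneg_right η.2)

lemma shift_mono {r : ℝ} (η : ℝ≥0) {ε ε' : Set.Ici r} (h : ε ≤ ε') : shift η ε ≤ shift η ε' :=
  Subtype.coe_le_coe.1 (add_le_add_left (Subtype.coe_le_coe.2 h) (η : ℝ))

/-- Two towers of covers are `η`-interleaved if there are maps of covers `𝒰_ε → 𝒱_{ε+η}` and
`𝒱_ε → 𝒰_{ε+η}` for all `ε ≥ r`. -/
def CoverInterleaved.{w, w', v} {Z : Type v} [TopologicalSpace Z] {r : ℝ} (η : ℝ≥0)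
    (U : Tower r (OpenCover.{w, v} Z)) (V : Tower r (OpenCover.{w', v} Z)) : Prop :=
  (∀ ε, Nonempty (CoverMap (U.obj ε).toCover (V.obj (shift η ε)).toCover)) ∧
    (∀ ε, Nonempty (CoverMap (V.obj ε).toCover (U.obj (shift η ε)).toCover))

/-- Two towers of simplicial complexes are `η`-interleaved if there are simplicial maps
`φ_ε : S_ε → T_{ε+η}` and `ψ_ε : T_ε → S_{ε+η}` for all `ε ≥ r`, such that the two triangles and
the two parallelograms formed with the maps of the towers commute up to contiguity. -/
def SimplicialInterleaved.{w, w'} {r : ℝ} (η : ℝ≥0)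
    (S : Tower r FinComplex.{w}) (T : Tower r FinComplex.{w'}) : Prop :=
  ∃ (φ : ∀ ε, SimplicialMap (S.obj ε) (T.obj (shift η ε)))
    (ψ : ∀ ε, SimplicialMap (T.obj ε) (S.obj (shift η ε))),
    (∀ ε, ((φ ε).comp (ψ (shift η ε))).Contiguous
      (S.map (homOfLE ((le_shift η ε).trans (le_shift η (shift η ε)))))) ∧
    (∀ ε, ((ψ ε).comp (φ (shift η ε))).Contiguous
      (T.map (homOfLE ((le_shift η ε).trans (le_shift η (shift η ε)))))) ∧
    (∀ (ε ε' : Set.Ici r) (h : ε ≤ ε'),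
      (SimplicialMap.comp (S.map (homOfLE h)) (φ ε')).Contiguous
        ((φ ε).comp (T.map (homOfLE (shift_mono η h))))) ∧
    (∀ (ε ε' : Set.Ici r) (h : ε ≤ ε'),
      ((ψ ε).comp (S.map (homOfLE (shift_mono η h)))).Contiguous
        (SimplicialMap.comp (T.map (homOfLE h)) (ψ ε')))

/-- The multiscale mapper `MM(𝔘, f) = N(f*(𝔘))`. -/
def multiscaleMapper.{w, v, u} {X : Type u} {Z : Type v} [TopologicalSpace X] [TopologicalSpace Z]
    {r : ℝ} (U : Tower r (OpenCover.{w, v} Z)) (f : C(X, Z)) (hf : WellBehaved f) :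
    Tower r FinComplex.{max w u} :=
  U ⋙ pullbackFunctor f hf ⋙ nerveFunctor X

/-! ### Simplicial homology -/

/-- The simplicial set of ordered simplices of a complex `K`: its `n`-simplices are the tuples
`(v₀, …, vₙ)` of vertices, repetitions allowed, such that `{v₀, …, vₙ}` is a simplex of `K`. Its
chain complex is the ordered chain complex of `K`, which computes the simplicial homology
of `K`. -/
def orderedSimplices.{w} : FinComplex.{w} ⥤ SSet.{w} where
  obj K :=
    { obj := fun n => {s : Fin (n.unop.len + 1) → K.V //
        open scoped Classical in Finset.univ.image s ∈ K.complex.faces}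
      map := fun θ => ↾fun s => ⟨s.1 ∘ θ.unop.toOrderHom, by
        classical
        refine (K.complex.isRelLowerSet_faces s.2).2 ?_ (Finset.univ_nonempty.image _)
        intro v hv
        simp only [Finset.mem_image, Finset.mem_univ, true_and] at hv ⊢
        obtain ⟨i, rfl⟩ := hv
        exact ⟨_, rfl⟩⟩ }
  map {K L} f :=
    { app := fun n => ↾fun s => ⟨f.toFun ∘ s.1, by
        classical
        have h := f.image_mem _ s.2
        rw [Finset.image_image] at h
        exact h⟩ }

/-- The `k`-th simplicial homology functor with coefficients in the field `𝕜`. -/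
noncomputable def simplicialHomology.{w, t} (𝕜 : Type t) [Field 𝕜] (k : ℕ) :
    FinComplex.{w} ⥤ ModuleCat.{max w t} 𝕜 :=
  orderedSimplices.{w} ⋙ SSet.homologyFunctor (ModuleCat.of 𝕜 (ULift.{w} 𝕜)) k

/-! ### Persistence diagrams -/

/-- The rank of the map `M s → M t` of a tower of vector spaces with resolution `r`, where the
tower is extended by zero to all real scales `s < r`. -/
noncomputable def persistentRank.{w, t} {𝕜 : Type t} [Field 𝕜] {r : ℝ}
    (M : Tower r (ModuleCat.{w} 𝕜)) (s t : ℝ) : ℕ :=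
  open scoped Classical in
  if h : r ≤ s ∧ s ≤ t then
    Module.finrank 𝕜 (LinearMap.range
      (M.map (homOfLE (show (⟨s, h.1⟩ : Set.Ici r) ≤ ⟨t, h.1.trans h.2⟩ from h.2))).hom)
  else 0

/-- The same rank for `t ∈ ℝ ∪ {∞}`, with the convention that it is `0` for `t = ∞`. -/
noncomputable def persistentRankE.{w, t} {𝕜 : Type t} [Field 𝕜] {r : ℝ}
    (M : Tower r (ModuleCat.{w} 𝕜)) (s : ℝ) (t : EReal) : ℕ :=
  open scoped Classical in if t = ⊤ then 0 else persistentRank M s t.toReal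

/-- The number of classes that are born in the scales from `a` to `b` and die in the scales
from `c` to `d`, where `a < b < c < d ≤ ∞`. -/
noncomputable def boxMultiplicity.{w, t} {𝕜 : Type t} [Field 𝕜] {r : ℝ}
    (M : Tower r (ModuleCat.{w} 𝕜)) (a b c : ℝ) (d : EReal) : ℤ :=
  (persistentRank M b c - persistentRank M a c : ℤ) -
    (persistentRankE M b d - persistentRankE M a d : ℤ)

/-- The points `(birth, death)` with `birth < death`, `birth ∈ ℝ` and `death ∈ ℝ ∪ {∞}`. -/
abbrev DiagramPoint := {p : ℝ × EReal // (p.1 : EReal) < p.2}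

/-- A persistence diagram: a multiset of points above the diagonal, given by multiplicities. -/
abbrev PersistenceDiagram := DiagramPoint → ℕ

/-- The persistence diagram of a tower of finite-dimensional vector spaces. The multiplicity of
`(b, d)` is the least multiplicity of a box that has `(b, d)` in its interior; the neighbourhoods of
a point at infinity are the boxes that reach up to death `∞`. -/
noncomputable def persistenceDiagram.{w, t} {𝕜 : Type t} [Field 𝕜] {r : ℝ}
    (M : Tower r (ModuleCat.{w} 𝕜)) : PersistenceDiagram := fun p =>
  sInf {n : ℕ | ∃ (a b c : ℝ) (d : EReal),
    a < p.1.1 ∧ p.1.1 < b ∧ b < c ∧ (c : EReal) < p.1.2 ∧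
    (p.1.2 < d ∨ p.1.2 = ⊤ ∧ d = ⊤) ∧ (n : ℤ) = boxMultiplicity M a b c d}

/-- The `k`-th persistence diagram `D_k 𝔖` of a tower of simplicial complexes, with coefficients
in the field `𝕜`. -/
noncomputable def simplicialPersistenceDiagram.{w, t} (𝕜 : Type t) [Field 𝕜] (k : ℕ) {r : ℝ}
    (S : Tower r FinComplex.{w}) : PersistenceDiagram :=
  persistenceDiagram (S ⋙ simplicialHomology 𝕜 k)

namespace PersistenceDiagram

/-- The points of a diagram, repeated according to multiplicity. -/
abbrev Point (D : PersistenceDiagram) := Σ p : DiagramPoint, Fin (D p)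

/-- `p` and `q` are at `ℓ^∞` distance at most `δ`, where a point at infinity is at finite distance
only from points at infinity. -/
def Close (δ : ℝ≥0) (p q : DiagramPoint) : Prop :=
  |p.1.1 - q.1.1| ≤ δ ∧ p.1.2 ≤ q.1.2 + ((δ : ℝ) : EReal) ∧ q.1.2 ≤ p.1.2 + ((δ : ℝ) : EReal)

/-- `p` is at `ℓ^∞` distance at most `δ` from the diagonal. -/
def NearDiagonal (δ : ℝ≥0) (p : DiagramPoint) : Prop :=
  p.1.2 ≤ ((p.1.1 + 2 * δ : ℝ) : EReal)

/-- A partial matching of the points of `D` and `D'` that moves no point by more than `δ`, where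
the unmatched points are matched to the diagonal. -/
def HasMatching (D D' : PersistenceDiagram) (δ : ℝ≥0) : Prop :=
  ∃ P : Point D ≃. Point D',
    (∀ x y, y ∈ P x → Close δ x.1 y.1) ∧
    (∀ x, P x = none → NearDiagonal δ x.1) ∧
    (∀ y, P.symm y = none → NearDiagonal δ y.1)

/-- The bottleneck distance of two persistence diagrams. -/
noncomputable def bottleneckDist (D D' : PersistenceDiagram) : ℝ≥0∞ :=
  ⨅ (δ : ℝ≥0) (_ : HasMatching D D' δ), (δ : ℝ≥0∞)

end PersistenceDiagram

universe w w' v u t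

/-!
Contiguous simplicial maps induce the same map in homology, so an interleaving of towers of
simplicial complexes becomes an interleaving of persistence modules. Any two maps of covers
`U → V` induce contiguous maps of nerves: a point common to the members of a simplex of `N(U)` lies
in all the members of `V` to which either map sends them. Hence every square that the definition of
an interleaving asks for commutes up to contiguity, and only the existence of the maps of covers
matters.

For the stability of persistence diagrams, let `φ : M → N(η)` be one half of an interleaving. Its
image is a quotient of `M` and a submodule of `N(η)`, and the other half of the interleaving bounds
its kernel and cokernel by a shift of `2η`. Passing to a quotient can only shorten bars at their
death, passing to a submodule only at their birth. Ranking the bars with a given birth by their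
death, respectively those with a given death by their birth, embeds the bars of the image into
those of `M` and of `N(η)`, and a bar that is missed has length at most `2η`. Composing the two
embeddings gives the matching.
-/

/-! ### Rank functions -/

section RankFunction

open OrderDual

/-- The way-below relation of domain theory, in the form that it takes in a dense linear order with
a least element. -/
def WayBelow {α : Type*} [LT α] [Bot α] (a b : α) : Prop := a < b ∨ a = ⊥

/-- The way-below relation of the dual order: `a` lies strictly above `b`, or `a = ⊤`. -/
def WayAbove {α : Type*} [LT α] [Top α] (a b : α) : Prop := b < a ∨ a = ⊤

/-- The order-theoretic properties of the rank function `(s, t) ↦ rank (M s → M t)`, `s ≤ t`, of a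
persistence module that vanishes at the two ends of its index set. -/
structure IsRankFunction {α : Type*} [Preorder α] [BoundedOrder α] (ρ : α → α → ℕ) : Prop where
  mono : ∀ {s s' t}, s ≤ s' → s' ≤ t → ρ s t ≤ ρ s' t
  anti : ∀ {s t t'}, s ≤ t → t ≤ t' → ρ s t' ≤ ρ s t
  box : ∀ {a b c d}, a ≤ b → b ≤ c → c ≤ d → ρ b d + ρ a c ≤ ρ b c + ρ a d
  bot : ∀ t, ρ ⊥ t = 0
  top : ∀ s, ρ s ⊤ = 0

/-- Reversal of time, which exchanges births and deaths. -/
def dualRank {α : Type*} (ρ : α → α → ℕ) (s t : αᵒᵈ) : ℕ := ρ (ofDual t) (ofDual s)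

/-- The number of classes that are born between `a` and `b` and die between `c` and `d`. -/
def boxCount {α : Type*} (ρ : α → α → ℕ) (a b c d : α) : ℤ :=
  (ρ b c - ρ a c : ℤ) - (ρ b d - ρ a d : ℤ)

/-- The number of classes that are born at `b` and die at `d`: the least count of a box around
`(b, d)`. -/
noncomputable def pointMultiplicity {α : Type*} [Preorder α] [BoundedOrder α] (ρ : α → α → ℕ)
    (b d : α) : ℕ :=
  sInf {n : ℕ | ∃ a b' c d', WayBelow a b ∧ b < b' ∧ b' < c ∧ c < d ∧ WayAbove d' d ∧
    (n : ℤ) = boxCount ρ a b' c d'}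

section Order

variable {α : Type*} [LinearOrder α] [BoundedOrder α] {a a' b c : α}

lemma WayBelow.le (h : WayBelow a b) : a ≤ b := by
  rcases h with h | rfl
  exacts [h.le, bot_le]

lemma WayBelow.trans_lt (h : WayBelow a b) (hbc : b < c) : a < c := h.le.trans_lt hbc

lemma WayBelow.max (h : WayBelow a b) (h' : WayBelow a' b) : WayBelow (max a a') b := by
  rcases max_choice a a' with e | e <;> rwa [e]

lemma wayBelow_bot : WayBelow ⊥ b := Or.inr rfl

lemma WayAbove.le (h : WayAbove a b) : b ≤ a := WayBelow.le (α := αᵒᵈ) h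

lemma WayAbove.min (h : WayAbove a b) (h' : WayAbove a' b) : WayAbove (min a a') b :=
  WayBelow.max (α := αᵒᵈ) h h'

end Order

lemma boxCount_dualRank {α : Type*} (ρ : α → α → ℕ) (a b c d : α) :
    boxCount (dualRank ρ) (toDual d) (toDual c) (toDual b) (toDual a) = boxCount ρ a b c d := by
  simp only [boxCount, dualRank, ofDual_toDual]
  ring

lemma pointMultiplicity_dualRank {α : Type*} [Preorder α] [BoundedOrder α] (ρ : α → α → ℕ)
    (b d : α) :
    pointMultiplicity (dualRank ρ) (toDual d) (toDual b) = pointMultiplicity ρ b d := by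
  unfold pointMultiplicity
  congr 1
  ext n
  constructor
  · rintro ⟨d', c, b', a, hd, hc, hbc, hb, ha, hn⟩
    exact ⟨a, b', c, d', ha, hb, hbc, hc, hd, hn.trans (boxCount_dualRank ρ a b' c d')⟩
  · rintro ⟨a, b', c, d', ha, hb, hbc, hc, hd, hn⟩
    exact ⟨d', c, b', a, hd, hc, hbc, hb, ha, hn.trans (boxCount_dualRank ρ a b' c d').symm⟩

lemma pointMultiplicity_comp_orderIso {α : Type*} [PartialOrder α] [BoundedOrder α] (ρ : α → α → ℕ)
    (e : α ≃o α) (b d : α) :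
    pointMultiplicity (fun s t => ρ (e s) (e t)) b d = pointMultiplicity ρ (e b) (e d) := by
  have wayBelow_iff (x y : α) : WayBelow (e x) (e y) ↔ WayBelow x y :=
    or_congr e.lt_iff_lt (map_eq_bot_iff e)
  have wayAbove_iff (x y : α) : WayAbove (e x) (e y) ↔ WayAbove x y :=
    or_congr e.lt_iff_lt (map_eq_top_iff e)
  unfold pointMultiplicity
  congr 1
  ext n
  constructor
  · rintro ⟨a, b', c, d', h⟩
    refine ⟨e a, e b', e c, e d', ?_⟩
    rwa [wayBelow_iff, wayAbove_iff, e.lt_iff_lt, e.lt_iff_lt, e.lt_iff_lt]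
  · rintro ⟨a, b', c, d', h⟩
    obtain ⟨a, rfl⟩ := e.surjective a
    obtain ⟨b', rfl⟩ := e.surjective b'
    obtain ⟨c, rfl⟩ := e.surjective c
    obtain ⟨d', rfl⟩ := e.surjective d'
    rw [wayBelow_iff, wayAbove_iff, e.lt_iff_lt, e.lt_iff_lt, e.lt_iff_lt] at h
    exact ⟨a, b', c, d', h⟩

/-- A box around `(b, d)` on whose four corners the rank function is constant. -/
structure IsStableBox {α : Type*} [Preorder α] [BoundedOrder α] (ρ : α → α → ℕ)
    (b d a₀ b₀ c₀ d₀ : α) : Prop where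
  left : WayBelow a₀ b
  right : b < b₀
  lt : b₀ < c₀
  lower : c₀ < d
  upper : WayAbove d₀ d
  left_lower : ∀ {s x}, a₀ ≤ s → WayBelow s b → c₀ ≤ x → x < d → ρ s x = ρ a₀ c₀
  left_upper : ∀ {s x}, a₀ ≤ s → WayBelow s b → x ≤ d₀ → WayAbove x d → ρ s x = ρ a₀ d₀
  right_lower : ∀ {s x}, s ≤ b₀ → b < s → c₀ ≤ x → x < d → ρ s x = ρ b₀ c₀
  right_upper : ∀ {s x}, s ≤ b₀ → b < s → x ≤ d₀ → WayAbove x d → ρ s x = ρ b₀ d₀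

namespace IsRankFunction

section LinearOrder

variable {α : Type*} [LinearOrder α] [BoundedOrder α] {ρ : α → α → ℕ} (hρ : IsRankFunction ρ)
  {a b c d : α}

include hρ

protected lemma dualRank : IsRankFunction (dualRank ρ) where
  mono h h' := hρ.anti h' h
  anti h h' := hρ.mono h' h
  box h h' h'' := (add_comm _ _).trans_le (hρ.box h'' h' h)
  bot t := hρ.top (ofDual t)
  top s := hρ.bot (ofDual s)

lemma boxCount_nonneg (hab : a ≤ b) (hbc : b ≤ c) (hcd : c ≤ d) : 0 ≤ boxCount ρ a b c d := by
  have := hρ.box hab hbc hcd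
  simp only [boxCount]
  omega

lemma boxCount_mono {a' b' c' d' : α} (haa' : a ≤ a') (hab : a' ≤ b') (hbb' : b' ≤ b)
    (hbc : b ≤ c) (hcc' : c ≤ c') (hcd : c' ≤ d') (hdd' : d' ≤ d) :
    boxCount ρ a' b' c' d' ≤ boxCount ρ a b c d := by
  have widen_left := hρ.box haa' (hab.trans (hbb'.trans (hbc.trans hcc'))) hcd
  have widen_right := hρ.box hbb' (hbc.trans hcc') hcd
  have hab' : a ≤ b := haa'.trans (hab.trans hbb')
  have widen_lower := hρ.box hab' hbc hcc'
  have widen_upper := hρ.box hab' (hbc.trans (hcc'.trans hcd)) hdd'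
  simp only [boxCount]
  omega

lemma exists_const_left (hbc : b < c) : ∃ a₀, WayBelow a₀ b ∧
    ∀ s x, a₀ ≤ s → WayBelow s b → c ≤ x → ρ s x = ρ a₀ x := by
  obtain ⟨a₀, ha₀, hmax⟩ := exists_minimalFor_of_wellFoundedLT (fun s => WayBelow s b)
    (fun s => ρ b c - ρ s c) ⟨⊥, wayBelow_bot⟩
  refine ⟨a₀, ha₀, fun s x has hsb hcx => ?_⟩
  have hsc := hsb.trans_lt hbc
  have h₁ := hρ.mono has (hsc.le.trans hcx)
  have h₂ := hρ.box has hsc.le hcx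
  have h₃ := hρ.mono hsb.le hbc.le
  have h₄ := hρ.mono ha₀.le hbc.le
  have h₅ : ρ b c - ρ s c ≤ ρ b c - ρ a₀ c → ρ b c - ρ a₀ c ≤ ρ b c - ρ s c := hmax hsb
  omega

lemma exists_const_right [DenselyOrdered α] (hbc : b < c) : ∃ b₀, b < b₀ ∧ b₀ < c ∧
    ∀ s x, s ≤ b₀ → b < s → c ≤ x → ρ s x = ρ b₀ x := by
  obtain ⟨b₀, ⟨hb₀, hb₀c⟩, hmin⟩ := exists_minimalFor_of_wellFoundedLT (fun s => b < s ∧ s < c)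
    (fun s => ρ s c) (exists_between hbc)
  refine ⟨b₀, hb₀, hb₀c, fun s x hsb₀ hbs hcx => ?_⟩
  have h₁ := hρ.mono hsb₀ (hb₀c.le.trans hcx)
  have h₂ := hρ.box hsb₀ hb₀c.le hcx
  have h₃ : ρ s c ≤ ρ b₀ c → ρ b₀ c ≤ ρ s c := hmin ⟨hbs, hsb₀.trans_lt hb₀c⟩
  omega

lemma exists_isStableBox [DenselyOrdered α] (hbd : b < d) :
    ∃ a₀ b₀ c₀ d₀, IsStableBox ρ b d a₀ b₀ c₀ d₀ := by
  obtain ⟨m, hbm, hmd⟩ := exists_between hbd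
  obtain ⟨a₀, ha₀, const_left⟩ := hρ.exists_const_left hbm
  obtain ⟨b₀, hb₀, hb₀m, const_right⟩ := hρ.exists_const_right hbm
  obtain ⟨c₀, hc₀, (hmc₀ : m < c₀), const_lower⟩ :=
    hρ.dualRank.exists_const_right (toDual_lt_toDual.2 hmd)
  obtain ⟨d₀, hd₀, const_upper⟩ := hρ.dualRank.exists_const_left (toDual_lt_toDual.2 hmd)
  refine ⟨a₀, b₀, c₀, d₀, ha₀, hb₀, hb₀m.trans hmc₀, hc₀, hd₀, ?_, ?_, ?_, ?_⟩
  · intro s x hs hsb hx hxd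
    rw [const_left s x hs hsb (hmc₀.le.trans hx)]
    exact const_lower x a₀ hx hxd (ha₀.trans_lt hbm).le
  · intro s x hs hsb hx hxd
    rw [const_left s x hs hsb (hmd.le.trans hxd.le)]
    exact const_upper x a₀ hx hxd (ha₀.trans_lt hbm).le
  · intro s x hs hsb hx hxd
    rw [const_right s x hs hsb (hmc₀.le.trans hx)]
    exact const_lower x b₀ hx hxd hb₀m.le
  · intro s x hs hsb hx hxd
    rw [const_right s x hs hsb (hmd.le.trans hxd.le)]
    exact const_upper x b₀ hx hxd hb₀m.le

lemma pointMultiplicity_eq {a₀ b₀ c₀ d₀ : α} (h : IsStableBox ρ b d a₀ b₀ c₀ d₀) :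
    (pointMultiplicity ρ b d : ℤ) = boxCount ρ a₀ b₀ c₀ d₀ := by
  obtain ⟨n, hn⟩ := Int.eq_ofNat_of_zero_le (hρ.boxCount_nonneg (h.left.trans_lt h.right).le h.lt.le
    (h.lower.le.trans h.upper.le))
  rw [hn, Nat.cast_inj]
  refine IsLeast.csInf_eq
    ⟨⟨a₀, b₀, c₀, d₀, h.left, h.right, h.lt, h.lower, h.upper, hn.symm⟩, ?_⟩
  rintro m ⟨a, b', c, d', ha, hb, hbc, hc, hd, hm⟩
  rw [← Nat.cast_le (α := ℤ), ← hn, hm]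
  have ha' := ha.max h.left
  have hb' := lt_min hb h.right
  have hc' := max_lt hc h.lower
  have hd' := hd.min h.upper
  have shrink : boxCount ρ a₀ b₀ c₀ d₀ =
      boxCount ρ (max a a₀) (min b' b₀) (max c c₀) (min d' d₀) := by
    simp only [boxCount, h.left_lower (le_max_right a a₀) ha' (le_max_right c c₀) hc',
      h.left_upper (le_max_right a a₀) ha' (min_le_right d' d₀) hd',
      h.right_lower (min_le_right b' b₀) hb' (le_max_right c c₀) hc',
      h.right_upper (min_le_right b' b₀) hb' (min_le_right d' d₀) hd']
  rw [shrink]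
  exact hρ.boxCount_mono (le_max_left _ _) (ha'.trans_lt hb').le (min_le_left _ _) hbc.le
    (le_max_left _ _) (hc'.le.trans hd'.le) (min_le_left _ _)

end LinearOrder

end IsRankFunction

/-- More than `i` of the classes that are born at `b` are alive just before `x`. -/
def BornAlive {α : Type*} [Preorder α] [OrderBot α] (ρ : α → α → ℕ) (b : α) (i : ℕ) (x : α) :
    Prop :=
  ∀ a b', WayBelow a b → b < b' → b' < x → ρ a x + i < ρ b' x

/-- The death of the `i`-th class that is born at `b`, where these classes are listed by decreasing
lifetime. If there are at most `i` such classes, the value is `b`. -/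
noncomputable def deathTime {α : Type*} [CompleteLinearOrder α] (ρ : α → α → ℕ) (b : α) (i : ℕ) :
    α :=
  sSup {x | BornAlive ρ b i x}

namespace IsRankFunction

section BornAlive

variable {α : Type*} [LinearOrder α] [BoundedOrder α] {ρ : α → α → ℕ} (hρ : IsRankFunction ρ)
  {b d x x' : α} {i : ℕ}

include hρ

lemma bornAlive_anti (hx : x ≤ x') (h : BornAlive ρ b i x') : BornAlive ρ b i x := by
  intro a b' ha hb hbx
  have h₁ := h a b' ha hb (hbx.trans_le hx)
  have h₂ := hρ.box (ha.trans_lt hb).le hbx.le hx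
  omega

variable [DenselyOrdered α]

lemma not_bornAlive_top (hb : b < ⊤) : ¬ BornAlive ρ b i ⊤ := by
  intro h
  obtain ⟨b', hb', hb'_top⟩ := exists_between hb
  have := h ⊥ b' wayBelow_bot hb' hb'_top
  simp [hρ.top] at this

lemma bornAlive_iff {a₀ b₀ : α} {m n : ℕ} (hbx : b < x) (ha₀ : WayBelow a₀ b) (hb₀ : b < b₀)
    (hm : ∀ s, a₀ ≤ s → WayBelow s b → ρ s x = m) (hn : ∀ s, s ≤ b₀ → b < s → ρ s x = n) :
    BornAlive ρ b i x ↔ m + i < n := by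
  constructor
  · intro h
    obtain ⟨b', hb', hb'x⟩ := exists_between (lt_min hb₀ hbx)
    have := h a₀ b' ha₀ hb' (hb'x.trans_le (min_le_right _ _))
    rwa [hm a₀ le_rfl ha₀, hn b' (hb'x.le.trans (min_le_left _ _)) hb'] at this
  · intro h a b' ha hb' hb'x
    have left : ρ a x ≤ m := by
      rw [← hm (max a a₀) (le_max_right _ _) (ha.max ha₀)]
      exact hρ.mono (le_max_left _ _) ((ha.max ha₀).le.trans hbx.le)
    have right : n ≤ ρ b' x := by
      rw [← hn (min b' b₀) (min_le_right _ _) (lt_min hb' hb₀)]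
      exact hρ.mono (min_le_left _ _) hb'x.le
    omega

variable {a₀ b₀ c₀ d₀ : α} (h : IsStableBox ρ b d a₀ b₀ c₀ d₀)

include h

lemma bornAlive_iff_lower (hx : c₀ ≤ x) (hxd : x < d) :
    BornAlive ρ b i x ↔ ρ a₀ c₀ + i < ρ b₀ c₀ :=
  hρ.bornAlive_iff (h.right.trans (h.lt.trans_le hx)) h.left h.right
    (fun _ hs hsb => h.left_lower hs hsb hx hxd) (fun _ hs hbs => h.right_lower hs hbs hx hxd)

lemma bornAlive_iff_upper (hx : x ≤ d₀) (hxd : WayAbove x d) :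
    BornAlive ρ b i x ↔ ρ a₀ d₀ + i < ρ b₀ d₀ :=
  hρ.bornAlive_iff (h.right.trans (h.lt.trans (h.lower.trans_le hxd.le))) h.left h.right
    (fun _ hs hsb => h.left_upper hs hsb hx hxd) (fun _ hs hbs => h.right_upper hs hbs hx hxd)

end BornAlive

section DeathTime

variable {α : Type*} [CompleteLinearOrder α] [DenselyOrdered α] {ρ : α → α → ℕ}
  (hρ : IsRankFunction ρ) {b d : α} {i : ℕ}

include hρ

lemma deathTime_eq_iff {a₀ b₀ c₀ d₀ : α} (h : IsStableBox ρ b d a₀ b₀ c₀ d₀) :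
    deathTime ρ b i = d ↔ ρ a₀ c₀ + i < ρ b₀ c₀ ∧ ρ b₀ d₀ ≤ ρ a₀ d₀ + i := by
  rw [← hρ.bornAlive_iff_lower h le_rfl h.lower, ← not_lt,
    ← hρ.bornAlive_iff_upper h le_rfl h.upper]
  constructor
  · rintro rfl
    obtain ⟨x, hx, hc₀x⟩ := lt_sSup_iff.1 h.lower
    refine ⟨hρ.bornAlive_anti hc₀x.le hx, fun alive => ?_⟩
    rcases h.upper with hd₀ | rfl
    · exact hd₀.not_ge (le_sSup alive)
    · exact hρ.not_bornAlive_top (h.right.trans (h.lt.trans (h.lower.trans_le le_top))) alive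
  · rintro ⟨alive, dead⟩
    refine le_antisymm (sSup_le fun x hx => le_of_not_gt fun hdx => dead ?_)
      (le_of_forall_lt_imp_le_of_dense fun c hc => ?_)
    · rw [hρ.bornAlive_iff_upper h le_rfl h.upper,
        ← hρ.bornAlive_iff_upper h (min_le_right x d₀) (WayAbove.min (Or.inl hdx) h.upper)]
      exact hρ.bornAlive_anti (min_le_left _ _) hx
    · rw [hρ.bornAlive_iff_lower h le_rfl h.lower,
        ← hρ.bornAlive_iff_lower h (le_max_right c c₀) (max_lt hc h.lower)] at alive
      exact (le_max_left _ _).trans (le_sSup alive)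

lemma nonempty_equiv_fin_pointMultiplicity (hbd : b < d) :
    Nonempty (Fin (pointMultiplicity ρ b d) ≃ {i // deathTime ρ b i = d}) := by
  obtain ⟨a₀, b₀, c₀, d₀, h⟩ := hρ.exists_isStableBox hbd
  have card : (Finset.Ico (ρ b₀ d₀ - ρ a₀ d₀) (ρ b₀ c₀ - ρ a₀ c₀)).card =
      pointMultiplicity ρ b d := by
    have hab := (h.left.trans_lt h.right).le
    have hcd := h.lower.le.trans h.upper.le
    have multiplicity := hρ.pointMultiplicity_eq h
    have upper_mono := hρ.mono hab (h.lt.le.trans hcd)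
    simp only [boxCount] at multiplicity
    rw [Nat.card_Ico]
    omega
  refine ⟨(Finset.equivFinOfCardEq card).symm.trans (Equiv.subtypeEquivRight fun i => ?_)⟩
  rw [hρ.deathTime_eq_iff h, Finset.mem_Ico]
  omega

end DeathTime

end IsRankFunction

/-- The points of the persistence diagram of a rank function, repeated according to
multiplicity. -/
abbrev RankPoint {α : Type*} [Preorder α] [BoundedOrder α] (ρ : α → α → ℕ) : Type _ :=
  Σ p : {p : α × α // p.1 < p.2}, Fin (pointMultiplicity ρ p.1.1 p.1.2)

namespace RankPoint

variable {α : Type*} [Preorder α] [BoundedOrder α] {ρ : α → α → ℕ}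

/-- The birth time of a point. -/
abbrev birth (x : RankPoint ρ) : α := x.1.1.1

/-- The death time of a point. -/
abbrev death (x : RankPoint ρ) : α := x.1.1.2

/-- The points of a diagram are the points of the diagram for reversed time. -/
noncomputable def dual (ρ : α → α → ℕ) : RankPoint (dualRank ρ) ≃ RankPoint ρ :=
  Equiv.sigmaCongr
    { toFun := fun p => ⟨(ofDual p.1.2, ofDual p.1.1), p.2⟩
      invFun := fun p => ⟨(toDual p.1.2, toDual p.1.1), p.2⟩ }
    fun p => finCongr (pointMultiplicity_dualRank ρ (ofDual p.1.2) (ofDual p.1.1))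

end RankPoint

/-- The points of a diagram are the points of the diagram after a reparametrization of time. -/
noncomputable def RankPoint.reparametrize {α : Type*} [PartialOrder α] [BoundedOrder α]
    (ρ : α → α → ℕ) (e : α ≃o α) : RankPoint (fun s t => ρ (e s) (e t)) ≃ RankPoint ρ :=
  Equiv.sigmaCongr
    { toFun := fun p => ⟨(e p.1.1, e p.1.2), e.lt_iff_lt.2 p.2⟩
      invFun := fun p => ⟨(e.symm p.1.1, e.symm p.1.2), e.symm.lt_iff_lt.2 p.2⟩
      left_inv := fun p => by simp
      right_inv := fun p => by simp }
    fun p => finCongr (pointMultiplicity_comp_orderIso ρ e p.1.1 p.1.2)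

/-- The classes of positive lifetime, indexed by their birth and their position in the list of
classes with this birth. -/
abbrev Bar {α : Type*} [CompleteLinearOrder α] (ρ : α → α → ℕ) : Type _ :=
  {p : α × ℕ // p.1 < deathTime ρ p.1 p.2}

lemma IsRankFunction.exists_equiv_bar {α : Type*} [CompleteLinearOrder α] [DenselyOrdered α]
    {ρ : α → α → ℕ} (hρ : IsRankFunction ρ) : ∃ e : RankPoint ρ ≃ Bar ρ,
      ∀ x, (e x).1.1 = x.birth ∧ deathTime ρ x.birth (e x).1.2 = x.death := by
  let fibres : (Σ p : {p : α × α // p.1 < p.2}, {i // deathTime ρ p.1.1 i = p.1.2}) ≃ Bar ρ :=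
    { toFun := fun x => ⟨(x.1.1.1, x.2.1), x.1.2.trans_eq x.2.2.symm⟩
      invFun := fun z => ⟨⟨(z.1.1, deathTime ρ z.1.1 z.1.2), z.2⟩, ⟨z.1.2, rfl⟩⟩
      left_inv := by
        rintro ⟨⟨⟨b, d⟩, hbd⟩, ⟨i, hi : deathTime ρ b i = d⟩⟩
        subst hi
        rfl
      right_inv := fun z => rfl }
  let index (p : {p : α × α // p.1 < p.2}) :=
    (hρ.nonempty_equiv_fin_pointMultiplicity p.2).some
  exact ⟨(Equiv.sigmaCongrRight index).trans fibres, fun x => ⟨rfl, (index x.1 x.2).2⟩⟩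

lemma IsRankFunction.comp_orderIso {α : Type*} [LinearOrder α] [BoundedOrder α] {ρ : α → α → ℕ}
    (hρ : IsRankFunction ρ) (e : α ≃o α) : IsRankFunction fun s t => ρ (e s) (e t) where
  mono h h' := hρ.mono (e.monotone h) (e.monotone h')
  anti h h' := hρ.anti (e.monotone h) (e.monotone h')
  box h h' h'' := hρ.box (e.monotone h) (e.monotone h') (e.monotone h'')
  bot t := by rw [map_bot, hρ.bot]
  top s := by rw [map_top, hρ.top]

/-- The inequalities between the rank function `ρ` of a persistence module `M` and the rank
function `τ` of a quotient `Q` of `M` such that the maps `M t → M (e t)` factor through `Q t`. -/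
structure IsQuotientRank {α : Type*} [LE α] (e : α ≃o α) (ρ τ : α → α → ℕ) : Prop where
  le : ∀ {s s' t}, s ≤ s' → s' ≤ t → τ s' t + ρ s t ≤ ρ s' t + τ s t
  le_shift : ∀ {s s' t}, s ≤ s' → s' ≤ t → ρ s' (e t) + τ s t ≤ τ s' t + ρ s (e t)

/-- The inequalities between the rank function `ρ` of a persistence module `N` and the rank
function `τ` of a submodule `S` of `N` such that the maps `N s → N (e s)` factor through
`S (e s)`. -/
structure IsSubmoduleRank {α : Type*} [LE α] (e : α ≃o α) (ρ τ : α → α → ℕ) : Prop where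
  le : ∀ {s t t'}, s ≤ t → t ≤ t' → τ s t + ρ s t' ≤ ρ s t + τ s t'
  le_shift : ∀ {s t t'}, e s ≤ t → t ≤ t' → ρ s t + τ (e s) t' ≤ τ (e s) t + ρ s t'

lemma IsSubmoduleRank.dual {α : Type*} [LE α] {e : α ≃o α} {ρ τ : α → α → ℕ}
    (h : IsSubmoduleRank e ρ τ) : IsQuotientRank e.symm.dual (dualRank ρ) (dualRank τ) where
  le hs ht := h.le ht hs
  le_shift {s s' t} hs ht := by
    have := h.le_shift (s := e.symm (ofDual t)) (t := ofDual s') (t' := ofDual s)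
      ((e.apply_symm_apply _).trans_le ht) hs
    rwa [e.apply_symm_apply] at this

section Matching

variable {α : Type*} [CompleteLinearOrder α] {e : α ≃o α} {ρ ρ' τ : α → α → ℕ}

namespace IsQuotientRank

lemma deathTime_le (h : IsQuotientRank e ρ τ) (b : α) (i : ℕ) :
    deathTime τ b i ≤ deathTime ρ b i := by
  refine sSup_le_sSup fun x hx a b' ha hb hb'x => ?_
  have h₁ := hx a b' ha hb hb'x
  have h₂ := h.le (ha.trans_lt hb).le hb'x.le
  omega

lemma deathTime_le_shift (he : ∀ x, x ≤ e x) (h : IsQuotientRank e ρ τ) (b : α) (i : ℕ) :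
    deathTime ρ b i ≤ e (deathTime τ b i) := by
  refine sSup_le fun y hy => (e.symm_apply_le).1 (le_sSup fun a b' ha hb hb'x => ?_)
  have h₁ := hy a b' ha hb (hb'x.trans_le ((he _).trans_eq (e.apply_symm_apply y)))
  have h₂ := h.le_shift (ha.trans_lt hb).le hb'x.le
  rw [e.apply_symm_apply] at h₂
  omega

variable [DenselyOrdered α]

theorem exists_embedding (hρ : IsRankFunction ρ) (hτ : IsRankFunction τ) (he : ∀ x, x ≤ e x)
    (h : IsQuotientRank e ρ τ) : ∃ ι : RankPoint τ ↪ RankPoint ρ,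
      (∀ z, (ι z).birth = z.birth ∧ z.death ≤ (ι z).death ∧ (ι z).death ≤ e z.death) ∧
      ∀ x : RankPoint ρ, e x.birth < x.death → x ∈ Set.range ι := by
  obtain ⟨f, hf⟩ := hρ.exists_equiv_bar
  obtain ⟨g, hg⟩ := hτ.exists_equiv_bar
  let prolong : Bar τ ↪ Bar ρ :=
    Subtype.impEmbedding _ _ fun p hp => hp.trans_le (h.deathTime_le p.1 p.2)
  refine ⟨(g.toEmbedding.trans prolong).trans f.symm.toEmbedding, fun z => ?_, fun x hx => ?_⟩
  · obtain ⟨x, hx⟩ := f.surjective (prolong (g z))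
    have same_bar : (f x).1 = (g z).1 := congrArg Subtype.val hx
    have birth : x.birth = z.birth := by rw [← (hf x).1, ← (hg z).1, same_bar]
    have image : ((g.toEmbedding.trans prolong).trans f.symm.toEmbedding) z = x :=
      f.symm_apply_eq.2 hx.symm
    rw [image, ← (hf x).2, ← (hg z).2, same_bar, birth]
    exact ⟨rfl, h.deathTime_le _ _, h.deathTime_le_shift he _ _⟩
  · have positive : (f x).1.1 < deathTime τ (f x).1.1 (f x).1.2 := by
      rw [(hf x).1, ← e.lt_iff_lt]
      refine hx.trans_le ?_
      rw [← (hf x).2]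
      exact h.deathTime_le_shift he _ _
    exact ⟨g.symm ⟨(f x).1, positive⟩, f.symm_apply_eq.2 (by
      simp only [Function.Embedding.trans_apply, Equiv.coe_toEmbedding, Equiv.apply_symm_apply]
      rfl)⟩

end IsQuotientRank

variable [DenselyOrdered α]

theorem IsSubmoduleRank.exists_embedding (hρ : IsRankFunction ρ) (hτ : IsRankFunction τ)
    (he : ∀ x, x ≤ e x) (h : IsSubmoduleRank e ρ τ) : ∃ κ : RankPoint τ ↪ RankPoint ρ,
      (∀ z, (κ z).death = z.death ∧ (κ z).birth ≤ z.birth ∧ z.birth ≤ e (κ z).birth) ∧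
      ∀ y : RankPoint ρ, e y.birth < y.death → y ∈ Set.range κ := by
  obtain ⟨κ, hκ, range⟩ := h.dual.exists_embedding hρ.dualRank hτ.dualRank
    fun x => (e.symm_apply_le).2 (he (ofDual x))
  refine ⟨((RankPoint.dual τ).symm.toEmbedding.trans κ).trans (RankPoint.dual ρ).toEmbedding,
    fun z => ?_, fun y hy => ?_⟩
  · obtain ⟨death, birth, birth'⟩ := hκ ((RankPoint.dual τ).symm z)
    exact ⟨death, birth, (e.symm_apply_le).1 birth'⟩
  · obtain ⟨z, hz⟩ := range ((RankPoint.dual ρ).symm y) ((e.lt_symm_apply).2 hy)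
    exact ⟨RankPoint.dual τ z, by simp [hz]⟩

lemma exists_pequiv_of_embeddings {γ A B : Type*} (ι : γ ↪ A) (κ : γ ↪ B) :
    ∃ P : A ≃. B, ∀ x y, y ∈ P x ↔ ∃ z, ι z = x ∧ κ z = y := by
  have mem_ι (x : A) (z : γ) : Function.partialInv ι x = some z ↔ ι z = x :=
    ι.injective.isPartialInv z x
  have mem_κ (y : B) (z : γ) : Function.partialInv κ y = some z ↔ κ z = y :=
    κ.injective.isPartialInv z y
  exact ⟨{ toFun := fun x => (Function.partialInv ι x).map κ
           invFun := fun y => (Function.partialInv κ y).map ι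
           inv := fun x y => by simp [mem_ι, mem_κ, and_comm] }, fun x y => by simp [mem_ι]⟩

/-- The induced matching of Bauer and Lesnick, along the image of a morphism. -/
theorem exists_matching (hρ : IsRankFunction ρ) (hρ' : IsRankFunction ρ') (hτ : IsRankFunction τ)
    (he : ∀ x, x ≤ e x) (hquot : IsQuotientRank e ρ τ) (hsub : IsSubmoduleRank e ρ' τ) :
    ∃ P : RankPoint ρ ≃. RankPoint ρ',
      (∀ x y, y ∈ P x → (y.birth ≤ x.birth ∧ x.birth ≤ e y.birth) ∧
        y.death ≤ x.death ∧ x.death ≤ e y.death) ∧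
      (∀ x, P x = none → x.death ≤ e x.birth) ∧
      ∀ y, P.symm y = none → y.death ≤ e y.birth := by
  obtain ⟨ι, hι, range_ι⟩ := hquot.exists_embedding hρ hτ he
  obtain ⟨κ, hκ, range_κ⟩ := hsub.exists_embedding hρ' hτ he
  obtain ⟨P, hP⟩ := exists_pequiv_of_embeddings ι κ
  refine ⟨P, fun x y hxy => ?_, fun x hx => le_of_not_gt fun long => ?_,
    fun y hy => le_of_not_gt fun long => ?_⟩
  · obtain ⟨z, rfl, rfl⟩ := (hP x y).1 hxy
    rw [(hι z).1, (hκ z).1]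
    exact ⟨(hκ z).2, (hι z).2⟩
  · obtain ⟨z, rfl⟩ := range_ι x long
    exact Option.ne_none_iff_exists'.2 ⟨κ z, (hP _ _).2 ⟨z, rfl, rfl⟩⟩ hx
  · obtain ⟨z, rfl⟩ := range_κ y long
    exact Option.ne_none_iff_exists'.2 ⟨ι z, P.mem_iff_mem.2 ((hP _ _).2 ⟨z, rfl, rfl⟩)⟩ hy

theorem exists_interleaved_matching (hρ : IsRankFunction ρ) (hρ' : IsRankFunction ρ')
    (hτ : IsRankFunction τ) (he : ∀ x, x ≤ e x) (hquot : IsQuotientRank (e.trans e) ρ τ)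
    (hsub : IsSubmoduleRank (e.trans e) (fun s t => ρ' (e s) (e t)) τ) :
    ∃ P : RankPoint ρ ≃. RankPoint ρ',
      (∀ x y, y ∈ P x → (y.birth ≤ e x.birth ∧ x.birth ≤ e y.birth) ∧
        y.death ≤ e x.death ∧ x.death ≤ e y.death) ∧
      (∀ x, P x = none → x.death ≤ e (e x.birth)) ∧
      ∀ y, P.symm y = none → y.death ≤ e (e y.birth) := by
  obtain ⟨P, hP, unmatched, unmatched'⟩ := exists_matching hρ (hρ'.comp_orderIso e) hτ
    (fun x => (he x).trans (he (e x))) hquot hsub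
  let reparam := RankPoint.reparametrize ρ' e
  refine ⟨P.trans reparam.toPEquiv, fun x y hxy => ?_, fun x hx => unmatched x ?_, fun y hy => ?_⟩
  · obtain ⟨y, hy, image⟩ := (PEquiv.mem_trans _ _ _ _).1 hxy
    obtain rfl := Option.some_injective _ image
    obtain ⟨⟨b, b'⟩, d, d'⟩ := hP x y hy
    exact ⟨⟨e.monotone b, b'⟩, e.monotone d, d'⟩
  · by_contra! hne
    obtain ⟨y, hy⟩ := Option.ne_none_iff_exists'.1 hne
    exact (PEquiv.trans_eq_none _ _ _).1 hx y (reparam y) |>.elim (· hy) (· rfl)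
  · obtain ⟨y, rfl⟩ := reparam.surjective y
    refine e.monotone (unmatched' y ?_)
    by_contra! hne
    obtain ⟨x, hx⟩ := Option.ne_none_iff_exists'.1 hne
    have : reparam y ∈ P.trans reparam.toPEquiv x :=
      (PEquiv.mem_trans _ _ _ _).2 ⟨y, P.mem_iff_mem.1 hx, rfl⟩
    rw [← PEquiv.mem_iff_mem, hy] at this
    cases this

end Matching

end RankFunction

/-! ### Persistence modules -/

lemma finrank_map_add_finrank_inf_ker {𝕜 V W : Type*} [DivisionRing 𝕜] [AddCommGroup V]
    [Module 𝕜 V] [AddCommGroup W] [Module 𝕜 W] (f : V →ₗ[𝕜] W) (p : Submodule 𝕜 V)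
    [Module.Finite 𝕜 p] :
    Module.finrank 𝕜 (p.map f) + Module.finrank 𝕜 ↥(p ⊓ LinearMap.ker f) =
      Module.finrank 𝕜 p := by
  rw [← Submodule.map_comap_subtype, Submodule.finrank_map_subtype_eq, ← LinearMap.ker_domRestrict,
    ← LinearMap.range_domRestrict, LinearMap.finrank_range_add_finrank_ker]

lemma finrank_range_eq_of_equiv {𝕜 A B A' B' : Type*} [Ring 𝕜] [AddCommGroup A] [Module 𝕜 A]
    [AddCommGroup B] [Module 𝕜 B] [AddCommGroup A'] [Module 𝕜 A'] [AddCommGroup B'] [Module 𝕜 B']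
    (i : A ≃ₗ[𝕜] A') (j : B ≃ₗ[𝕜] B') {f : A →ₗ[𝕜] B} {g : A' →ₗ[𝕜] B'}
    (h : j.toLinearMap ∘ₗ f = g ∘ₗ i.toLinearMap) :
    Module.finrank 𝕜 (LinearMap.range f) = Module.finrank 𝕜 (LinearMap.range g) := by
  rw [← LinearEquiv.range_comp i g, ← h, LinearMap.range_comp, LinearEquiv.finrank_map_eq]

section Interleaving

variable {J : Type*} [Preorder J] {C : Type*} [Category* C] {σ : J → J}

/-- An interleaving of two persistence objects along a reparametrization `σ` of time. -/
structure Interleaving (hσ : Monotone σ) (le : ∀ j, j ≤ σ j) (M N : J ⥤ C) where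
  hom : ∀ j, M.obj j ⟶ N.obj (σ j)
  inv : ∀ j, N.obj j ⟶ M.obj (σ j)
  hom_naturality : ∀ {j k} (h : j ≤ k),
    M.map (homOfLE h) ≫ hom k = hom j ≫ N.map (homOfLE (hσ h))
  inv_naturality : ∀ {j k} (h : j ≤ k),
    N.map (homOfLE h) ≫ inv k = inv j ≫ M.map (homOfLE (hσ h))
  hom_inv : ∀ j, hom j ≫ inv (σ j) = M.map (homOfLE ((le j).trans (le (σ j))))
  inv_hom : ∀ j, inv j ≫ hom (σ j) = N.map (homOfLE ((le j).trans (le (σ j))))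

namespace Interleaving

variable {hσ : Monotone σ} {le : ∀ j, j ≤ σ j} {M N : J ⥤ C} (I : Interleaving hσ le M N)

/-- The first half of an interleaving, as a morphism to the reparametrized object. -/
@[simps]
def homNatTrans : M ⟶ hσ.functor ⋙ N where
  app := I.hom
  naturality _ _ h := I.hom_naturality h.le

lemma inv_comp_hom_comp_map {j k : J} (h : σ (σ j) ≤ k) :
    I.inv j ≫ I.hom (σ j) ≫ N.map (homOfLE h) =
      N.map (homOfLE (((le j).trans (le (σ j))).trans h)) := by
  rw [← Category.assoc, I.inv_hom, ← N.map_comp, homOfLE_comp]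

end Interleaving

end Interleaving

section ModuleRank

universe u₂ u₁

variable {𝕜 : Type*} [Field 𝕜]

/-- The rank of a linear map. -/
noncomputable def homRank {A B : ModuleCat 𝕜} (f : A ⟶ B) : ℕ :=
  Module.finrank 𝕜 (LinearMap.range f.hom)

lemma homRank_eq_of_iso {A B A' B' : ModuleCat 𝕜} (i : A ≅ A') (j : B ≅ B') {f : A ⟶ B}
    {g : A' ⟶ B'} (h : f ≫ j.hom = i.hom ≫ g) : homRank f = homRank g :=
  finrank_range_eq_of_equiv i.toLinearEquiv j.toLinearEquiv (congrArg ModuleCat.Hom.hom h)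

lemma homRank_uliftFunctor_map {A B : ModuleCat.{u₁} 𝕜} (f : A ⟶ B) :
    homRank ((ModuleCat.uliftFunctor.{u₂} 𝕜).map f) = homRank f :=
  finrank_range_eq_of_equiv ULift.moduleEquiv ULift.moduleEquiv rfl

/-- The Frobenius rank inequality. -/
lemma homRank_comp_add_homRank_comp_le {A B C D : ModuleCat 𝕜} [Module.Finite 𝕜 C] (h : A ⟶ B)
    (g : B ⟶ C) (f : C ⟶ D) :
    homRank (h ≫ g) + homRank (g ≫ f) ≤ homRank g + homRank (h ≫ g ≫ f) := by
  have range_le : LinearMap.range (h ≫ g).hom ≤ LinearMap.range g.hom := by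
    rw [ModuleCat.hom_comp]
    exact LinearMap.range_comp_le_range _ _
  have range_comp : LinearMap.range (g ≫ f).hom = (LinearMap.range g.hom).map f.hom := by
    rw [ModuleCat.hom_comp, LinearMap.range_comp]
  have range_comp_comp : LinearMap.range (h ≫ g ≫ f).hom =
      (LinearMap.range (h ≫ g).hom).map f.hom := by
    rw [← Category.assoc, ModuleCat.hom_comp, LinearMap.range_comp]
  have rank_nullity := finrank_map_add_finrank_inf_ker f.hom (LinearMap.range g.hom)
  have rank_nullity' := finrank_map_add_finrank_inf_ker f.hom (LinearMap.range (h ≫ g).hom)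
  have kernel_le := Submodule.finrank_mono (inf_le_inf_right (LinearMap.ker f.hom) range_le)
  unfold homRank
  rw [range_comp, range_comp_comp]
  omega

@[simp]
lemma homRank_zero (A B : ModuleCat 𝕜) : homRank (0 : A ⟶ B) = 0 := by
  rw [homRank, ModuleCat.hom_zero, LinearMap.range_zero, finrank_bot]

lemma homRank_comp_le_left {A B C : ModuleCat 𝕜} [Module.Finite 𝕜 B] (g : A ⟶ B) (f : B ⟶ C) :
    homRank (g ≫ f) ≤ homRank g := by
  simpa using homRank_comp_add_homRank_comp_le (0 : A ⟶ A) g f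

lemma homRank_comp_le_right {A B C : ModuleCat 𝕜} [Module.Finite 𝕜 C] (h : A ⟶ B) (g : B ⟶ C) :
    homRank (h ≫ g) ≤ homRank g := by
  simpa using homRank_comp_add_homRank_comp_le h g (0 : C ⟶ C)

section Preorder

variable {α : Type*} [Preorder α] {M N P : α ⥤ ModuleCat 𝕜}

/-- The rank function of the image of a morphism of persistence modules. The rank function of `M`
is the case of the identity of `M`. -/
noncomputable def morphismRank (φ : M ⟶ N) (s t : α) : ℕ :=
  open scoped Classical in
  if h : s ≤ t then homRank (φ.app s ≫ N.map (homOfLE h)) else 0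

lemma morphismRank_of_le (φ : M ⟶ N) {s t : α} (h : s ≤ t) :
    morphismRank φ s t = homRank (φ.app s ≫ N.map (homOfLE h)) := dif_pos h

lemma morphismRank_id_of_le {s t : α} (h : s ≤ t) :
    morphismRank (𝟙 M) s t = homRank (M.map (homOfLE h)) := by
  rw [morphismRank_of_le _ h, NatTrans.id_app, Category.id_comp]

lemma morphismRank_of_isZero_left (φ : M ⟶ N) {s : α} (hs : Limits.IsZero (M.obj s)) (t : α) :
    morphismRank φ s t = 0 := by
  by_cases h : s ≤ t
  · rw [morphismRank_of_le _ h, hs.eq_of_src (_ ≫ _) 0, homRank_zero]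
  · exact dif_neg h

lemma morphismRank_of_isZero_right (φ : M ⟶ N) (s : α) {t : α} (ht : Limits.IsZero (N.obj t)) :
    morphismRank φ s t = 0 := by
  by_cases h : s ≤ t
  · rw [morphismRank_of_le _ h, ht.eq_of_tgt (_ ≫ _) 0, homRank_zero]
  · exact dif_neg h

lemma app_comp_map_eq (φ : M ⟶ N) {a b c : α} (hab : a ≤ b) (hbc : b ≤ c) :
    φ.app a ≫ N.map (homOfLE (hab.trans hbc)) =
      M.map (homOfLE hab) ≫ φ.app b ≫ N.map (homOfLE hbc) := by
  rw [φ.naturality_assoc, ← N.map_comp, homOfLE_comp]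

lemma isRankFunction_morphismRank [BoundedOrder α] [∀ x, Module.Finite 𝕜 (N.obj x)] (φ : M ⟶ N)
    (bot : Limits.IsZero (M.obj ⊥)) (top : Limits.IsZero (N.obj ⊤)) :
    IsRankFunction (morphismRank φ) where
  mono {s s' t} hs ht := by
    rw [morphismRank_of_le _ (hs.trans ht), morphismRank_of_le _ ht, app_comp_map_eq φ hs ht]
    exact homRank_comp_le_right _ _
  anti {s t t'} hs ht := by
    rw [morphismRank_of_le _ (hs.trans ht), morphismRank_of_le _ hs, ← homOfLE_comp hs ht,
      N.map_comp, ← Category.assoc]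
    exact homRank_comp_le_left _ _
  box {a b c d} hab hbc hcd := by
    have := homRank_comp_add_homRank_comp_le (M.map (homOfLE hab))
      (φ.app b ≫ N.map (homOfLE hbc)) (N.map (homOfLE hcd))
    simp only [Category.assoc, ← N.map_comp, homOfLE_comp] at this
    rw [← app_comp_map_eq φ hab hbc, ← app_comp_map_eq φ hab (hbc.trans hcd)] at this
    rw [morphismRank_of_le _ (hbc.trans hcd), morphismRank_of_le _ (hab.trans hbc),
      morphismRank_of_le _ hbc, morphismRank_of_le _ (hab.trans (hbc.trans hcd))]
    omega
  bot := morphismRank_of_isZero_left φ bot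
  top s := morphismRank_of_isZero_right φ s top

end Preorder

namespace Interleaving

variable {α : Type*} [PartialOrder α] {M N : α ⥤ ModuleCat 𝕜} {e : α ≃o α}
  {he : ∀ x, x ≤ e x} (I : Interleaving e.monotone he M N)

lemma morphismRank_homNatTrans_of_le {s t : α} (h : s ≤ t) :
    morphismRank I.homNatTrans s t = homRank (I.hom s ≫ N.map (homOfLE (e.monotone h))) :=
  morphismRank_of_le _ h

variable [∀ x, Module.Finite 𝕜 (N.obj x)]

lemma isQuotientRank [∀ x, Module.Finite 𝕜 (M.obj x)] :
    IsQuotientRank (e.trans e) (morphismRank (𝟙 M)) (morphismRank I.homNatTrans) where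
  le {s s' t} hs ht := by
    have := homRank_comp_add_homRank_comp_le (M.map (homOfLE hs)) (M.map (homOfLE ht)) (I.hom t)
    rw [← Category.assoc, ← M.map_comp, homOfLE_comp, I.hom_naturality, I.hom_naturality] at this
    rw [I.morphismRank_homNatTrans_of_le ht, I.morphismRank_homNatTrans_of_le (hs.trans ht),
      morphismRank_id_of_le ht, morphismRank_id_of_le (hs.trans ht)]
    omega
  le_shift {s s' t} hs ht := by
    have round_trip : (I.hom s' ≫ N.map (homOfLE (e.monotone ht))) ≫ I.inv (e t) =
        M.map (homOfLE (ht.trans ((he t).trans (he (e t))))) := by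
      rw [← I.hom_naturality ht, Category.assoc, I.hom_inv, ← M.map_comp, homOfLE_comp]
    have shift : M.map (homOfLE hs) ≫ I.hom s' ≫ N.map (homOfLE (e.monotone ht)) =
        I.hom s ≫ N.map (homOfLE (e.monotone (hs.trans ht))) := by
      rw [← Category.assoc, I.hom_naturality hs, Category.assoc, ← N.map_comp, homOfLE_comp]
    have := homRank_comp_add_homRank_comp_le (M.map (homOfLE hs))
      (I.hom s' ≫ N.map (homOfLE (e.monotone ht))) (I.inv (e t))
    rw [shift, round_trip, ← M.map_comp, homOfLE_comp] at this
    rw [OrderIso.trans_apply, I.morphismRank_homNatTrans_of_le ht,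
      I.morphismRank_homNatTrans_of_le (hs.trans ht),
      morphismRank_id_of_le (ht.trans ((he t).trans (he (e t)))),
      morphismRank_id_of_le ((hs.trans ht).trans ((he t).trans (he (e t))))]
    omega

lemma isSubmoduleRank : IsSubmoduleRank (e.trans e)
    (fun s t => morphismRank (𝟙 N) (e s) (e t)) (morphismRank I.homNatTrans) where
  le {s t t'} hs ht := by
    have := homRank_comp_add_homRank_comp_le (I.hom s) (N.map (homOfLE (e.monotone hs)))
      (N.map (homOfLE (e.monotone ht)))
    rw [← N.map_comp, homOfLE_comp] at this
    rwa [I.morphismRank_homNatTrans_of_le hs, I.morphismRank_homNatTrans_of_le (hs.trans ht),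
      morphismRank_id_of_le (e.monotone hs), morphismRank_id_of_le (e.monotone (hs.trans ht))]
  le_shift {s t t'} (hs : e (e s) ≤ t) ht := by
    have hs' := e.monotone ((he s).trans ((he (e s)).trans hs))
    have := homRank_comp_add_homRank_comp_le (I.inv (e s))
      (I.hom (e (e s)) ≫ N.map (homOfLE (e.monotone hs))) (N.map (homOfLE (e.monotone ht)))
    rw [Category.assoc, ← N.map_comp, homOfLE_comp, I.inv_comp_hom_comp_map,
      I.inv_comp_hom_comp_map] at this
    rw [OrderIso.trans_apply, I.morphismRank_homNatTrans_of_le hs,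
      I.morphismRank_homNatTrans_of_le (hs.trans ht), morphismRank_id_of_le hs',
      morphismRank_id_of_le (hs'.trans (e.monotone ht))]
    exact this

end Interleaving

theorem Interleaving.exists_matching {α : Type*} [CompleteLinearOrder α] [DenselyOrdered α]
    {M N : α ⥤ ModuleCat 𝕜} [∀ x, Module.Finite 𝕜 (M.obj x)] [∀ x, Module.Finite 𝕜 (N.obj x)]
    {e : α ≃o α} {he : ∀ x, x ≤ e x} (I : Interleaving e.monotone he M N)
    (hM : Limits.IsZero (M.obj ⊥)) (hM' : Limits.IsZero (M.obj ⊤))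
    (hN : Limits.IsZero (N.obj ⊥)) (hN' : Limits.IsZero (N.obj ⊤)) :
    ∃ P : RankPoint (morphismRank (𝟙 M)) ≃. RankPoint (morphismRank (𝟙 N)),
      (∀ x y, y ∈ P x → (y.birth ≤ e x.birth ∧ x.birth ≤ e y.birth) ∧
        y.death ≤ e x.death ∧ x.death ≤ e y.death) ∧
      (∀ x, P x = none → x.death ≤ e (e x.birth)) ∧
      ∀ y, P.symm y = none → y.death ≤ e (e y.birth) := by
  have (x : α) : Module.Finite 𝕜 ((e.monotone.functor ⋙ N).obj x) :=
    inferInstanceAs (Module.Finite 𝕜 (N.obj (e x)))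
  have shifted_top : Limits.IsZero ((e.monotone.functor ⋙ N).obj ⊤) := by
    change Limits.IsZero (N.obj (e ⊤))
    rwa [map_top]
  exact exists_interleaved_matching (isRankFunction_morphismRank (𝟙 M) hM hM')
    (isRankFunction_morphismRank (𝟙 N) hN hN')
    (isRankFunction_morphismRank I.homNatTrans hM shifted_top) he I.isQuotientRank
    I.isSubmoduleRank

end ModuleRank

/-! ### Persistence diagrams of towers -/

section ExtendByZero

universe v₁ w₁

variable {𝕜 : Type*} [Field 𝕜] {J : Type v₁} [Preorder J] {α : Type*} [PartialOrder α]
  {ι : J ↪o α}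

instance {x : α} : Subsingleton {j : J // ι j = x} :=
  ⟨fun j k => Subtype.ext (ι.injective (j.2.trans k.2.symm))⟩

lemma nonempty_fibre_of_ordConnected (hι : (Set.range ι).OrdConnected) {x y z : α} (hxy : x ≤ y)
    (hyz : y ≤ z) (hx : Nonempty {j : J // ι j = x}) (hz : Nonempty {j : J // ι j = z}) :
    Nonempty {j : J // ι j = y} := by
  obtain ⟨i, rfl⟩ := hx
  obtain ⟨k, rfl⟩ := hz
  obtain ⟨j, hj⟩ := hι.out ⟨i, rfl⟩ ⟨k, rfl⟩ ⟨hxy, hyz⟩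
  exact ⟨j, hj⟩

variable {M N P : J ⥤ ModuleCat.{w₁} 𝕜}

/-- The value at `x` of the extension by zero of `M` along `ι`. The product has at most one
factor. -/
abbrev extendObj (ι : J ↪o α) (M : J ⥤ ModuleCat.{w₁} 𝕜) (x : α) : ModuleCat.{max v₁ w₁} 𝕜 :=
  ModuleCat.of 𝕜 ((j : {j : J // ι j = x}) → M.obj j)

/-- The linear map between extensions by zero that is given by `g` where both sides come from
`J`. -/
noncomputable def extendHom {x y : α}
    (g : ∀ (j : {j : J // ι j = x}) (k : {k : J // ι k = y}), M.obj j ⟶ N.obj k) :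
    extendObj ι M x ⟶ extendObj ι N y :=
  open scoped Classical in
  if h : Nonempty {j : J // ι j = x} then
    ModuleCat.ofHom (LinearMap.pi fun k => (g h.some k).hom ∘ₗ LinearMap.proj h.some)
  else 0

lemma extendHom_apply {x y : α}
    (g : ∀ (j : {j : J // ι j = x}) (k : {k : J // ι k = y}), M.obj j ⟶ N.obj k)
    (m : extendObj ι M x) (j : {j : J // ι j = x}) (k : {k : J // ι k = y}) :
    (extendHom g).hom m k = (g j k).hom (m j) := by
  have h : Nonempty {j : J // ι j = x} := ⟨j⟩
  obtain rfl := Subsingleton.elim h.some j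
  rw [extendHom, dif_pos h]
  rfl

lemma isZero_extendObj {x : α} (hx : x ∉ Set.range ι) : Limits.IsZero (extendObj ι M x) := by
  have : IsEmpty {j : J // ι j = x} := ⟨fun j => hx ⟨j, j.2⟩⟩
  exact ModuleCat.isZero_of_subsingleton _

lemma extendObj_hom_ext {x y : α} {f f' : extendObj ι M x ⟶ extendObj ι N y}
    (h : ∀ (m : extendObj ι M x) (_ : {j : J // ι j = x}) (k : {k : J // ι k = y}),
      f.hom m k = f'.hom m k) : f = f' := by
  by_cases hx : x ∈ Set.range ι
  · obtain ⟨j, hj⟩ := hx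
    exact ModuleCat.hom_ext (LinearMap.ext fun m => funext fun k => h m ⟨j, hj⟩ k)
  · exact (isZero_extendObj hx).eq_of_src _ _

lemma extendHom_comp (hι : (Set.range ι).OrdConnected) {x y z : α} (hxy : x ≤ y) (hyz : y ≤ z)
    (g : ∀ (j : {j : J // ι j = x}) (k : {k : J // ι k = y}), M.obj j ⟶ N.obj k)
    (g' : ∀ (k : {k : J // ι k = y}) (l : {l : J // ι l = z}), N.obj k ⟶ P.obj l)
    (g'' : ∀ (j : {j : J // ι j = x}) (l : {l : J // ι l = z}), M.obj j ⟶ P.obj l)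
    (h : ∀ j k l, g j k ≫ g' k l = g'' j l) : extendHom g ≫ extendHom g' = extendHom g'' := by
  refine extendObj_hom_ext fun m j l => ?_
  obtain ⟨k⟩ := nonempty_fibre_of_ordConnected hι hxy hyz ⟨j⟩ ⟨l⟩
  rw [ModuleCat.hom_comp, LinearMap.comp_apply, extendHom_apply g' _ k l, extendHom_apply g m j k,
    extendHom_apply g'' m j l, ← h j k l]
  rfl

/-- The extension of `M` by zero to all of `α`. -/
noncomputable def extendByZero (hι : (Set.range ι).OrdConnected) (M : J ⥤ ModuleCat.{w₁} 𝕜) :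
    α ⥤ ModuleCat.{max v₁ w₁} 𝕜 where
  obj := extendObj ι M
  map {x y} f := extendHom fun j k => M.map (homOfLE (ι.le_iff_le.1 (by
    rw [j.2, k.2]
    exact f.le)))
  map_id x := extendObj_hom_ext fun m j k => by
    obtain rfl := Subsingleton.elim j k
    rw [extendHom_apply _ m j j]
    exact congrArg (fun f => f.hom (m j)) (M.map_id _)
  map_comp {x y z} f g := by
    refine (extendHom_comp hι f.le g.le _ _ _ fun j k l => ?_).symm
    rw [← M.map_comp, homOfLE_comp]

instance (hι : (Set.range ι).OrdConnected) [∀ j, Module.Finite 𝕜 (M.obj j)] (x : α) :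
    Module.Finite 𝕜 ((extendByZero hι M).obj x) :=
  inferInstanceAs (Module.Finite 𝕜 (∀ j : {j : J // ι j = x}, M.obj j))

lemma homRank_extendHom {x y : α}
    (g : ∀ (j : {j : J // ι j = x}) (k : {k : J // ι k = y}), M.obj j ⟶ N.obj k)
    (j : {j : J // ι j = x}) (k : {k : J // ι k = y}) :
    homRank (extendHom g) = homRank (g j k) := by
  let evalAt (P : J ⥤ ModuleCat.{w₁} 𝕜) {z : α} (l : {l : J // ι l = z}) :
      extendObj ι P z ≃ₗ[𝕜] P.obj l :=
    let _ : Unique {l : J // ι l = z} := ⟨⟨l⟩, fun _ => Subsingleton.elim _ _⟩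
    LinearEquiv.piUnique 𝕜 fun l : {l : J // ι l = z} => P.obj l
  have square : (evalAt N k).toLinearMap ∘ₗ (extendHom g).hom =
      (g j k).hom ∘ₗ (evalAt M j).toLinearMap :=
    LinearMap.ext fun m => extendHom_apply g m j k
  exact finrank_range_eq_of_equiv (evalAt M j) (evalAt N k) square

section Shift

variable {σ : J → J} {e : α ≃o α}

lemma shift_le_of_mem_fibre (hσe : ∀ j, ι (σ j) = e (ι j)) {x y : α} (hxy : e x ≤ y)
    (j : {j : J // ι j = x}) (k : {k : J // ι k = y}) : σ j ≤ k := by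
  rwa [← ι.le_iff_le, hσe, j.2, k.2]

/-- The extension by zero of a family of maps that shift time by `σ`, where `e` extends `σ`. -/
noncomputable def extendShift (hσe : ∀ j, ι (σ j) = e (ι j)) (f : ∀ j, M.obj j ⟶ N.obj (σ j))
    (x : α) : extendObj ι M x ⟶ extendObj ι N (e x) :=
  extendHom fun j k => f j ≫ N.map (homOfLE (shift_le_of_mem_fibre hσe le_rfl j k))

variable (hι : (Set.range ι).OrdConnected) (hσ : Monotone σ) (he : ∀ x, x ≤ e x)
  (hσe : ∀ j, ι (σ j) = e (ι j))

include hσ he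

lemma map_comp_extendShift (f : ∀ j, M.obj j ⟶ N.obj (σ j))
    (hf : ∀ {j k} (h : j ≤ k), M.map (homOfLE h) ≫ f k = f j ≫ N.map (homOfLE (hσ h)))
    {x y : α} (h : x ≤ y) :
    (extendByZero hι M).map (homOfLE h) ≫ extendShift hσe f y =
      extendShift hσe f x ≫ (extendByZero hι N).map (homOfLE (e.monotone h)) := by
  refine (extendHom_comp hι h (he y) _ _ (fun j k =>
    f j ≫ N.map (homOfLE (shift_le_of_mem_fibre hσe (e.monotone h) j k))) fun j k l => ?_).trans
    (extendHom_comp hι (he x) (e.monotone h) _ _ _ fun j k l => ?_).symm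
  · rw [← Category.assoc, hf, Category.assoc, ← N.map_comp, homOfLE_comp]
  · rw [Category.assoc, ← N.map_comp, homOfLE_comp]

lemma extendShift_comp_extendShift (le : ∀ j, j ≤ σ j) (f : ∀ j, M.obj j ⟶ N.obj (σ j))
    (g : ∀ j, N.obj j ⟶ M.obj (σ j))
    (hg : ∀ {j k} (h : j ≤ k), N.map (homOfLE h) ≫ g k = g j ≫ M.map (homOfLE (hσ h)))
    (hfg : ∀ j, f j ≫ g (σ j) = M.map (homOfLE ((le j).trans (le (σ j))))) (x : α) :
    extendShift hσe f x ≫ extendShift hσe g (e x) =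
      (extendByZero hι M).map (homOfLE ((he x).trans (he (e x)))) := by
  refine extendHom_comp hι (he x) (he (e x)) _ _
    (fun j l => M.map (homOfLE (((le j).trans (le (σ j))).trans
      (shift_le_of_mem_fibre hσe le_rfl ⟨σ j, (hσe j).trans (congrArg e j.2)⟩ l))))
    fun j k l => ?_
  rw [Category.assoc, ← Category.assoc (N.map _), hg, Category.assoc, ← M.map_comp,
    ← Category.assoc, hfg, ← M.map_comp, homOfLE_comp, homOfLE_comp]

/-- The extension of an interleaving by zero, along the extension `e` of the reparametrization
`σ` of time. -/
noncomputable def Interleaving.extendByZero {le : ∀ j, j ≤ σ j} (I : Interleaving hσ le M N) :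
    Interleaving e.monotone he (extendByZero hι M) (extendByZero hι N) where
  hom := extendShift hσe I.hom
  inv := extendShift hσe I.inv
  hom_naturality := map_comp_extendShift hι hσ he hσe I.hom I.hom_naturality
  inv_naturality := map_comp_extendShift hι hσ he hσe I.inv I.inv_naturality
  hom_inv := extendShift_comp_extendShift hι hσ he hσe le I.hom I.inv I.inv_naturality I.hom_inv
  inv_hom := extendShift_comp_extendShift hι hσ he hσe le I.inv I.hom I.hom_naturality I.inv_hom

end Shift

lemma morphismRank_extendByZero (hι : (Set.range ι).OrdConnected) (M : J ⥤ ModuleCat.{w₁} 𝕜)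
    {j k : J} (h : j ≤ k) :
    morphismRank (𝟙 (extendByZero hι M)) (ι j) (ι k) = homRank (M.map (homOfLE h)) := by
  rw [morphismRank_id_of_le (ι.monotone h)]
  exact homRank_extendHom _ ⟨j, rfl⟩ ⟨k, rfl⟩

end ExtendByZero

section RealTower

/-- Translation by a real number on the extended real line. -/
noncomputable def erealAddRight (c : ℝ) : EReal ≃o EReal where
  toFun x := x + c
  invFun x := x - c
  left_inv _ := EReal.add_sub_cancel_right
  right_inv _ := EReal.sub_add_cancel
  map_rel_iff' := (EReal.addLECancellable_coe c).add_le_add_iff_right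

/-- The scales of a tower, as extended real numbers. -/
noncomputable def scaleEmbedding (r : ℝ) : Set.Ici r ↪o EReal :=
  OrderEmbedding.ofMapLEIff (fun ε => ((ε : ℝ) : EReal)) fun _ _ => EReal.coe_le_coe_iff

variable {r : ℝ}

lemma coe_mem_range_scaleEmbedding {s : ℝ} : (s : EReal) ∈ Set.range (scaleEmbedding r) ↔ r ≤ s :=
  ⟨fun ⟨ε, hε⟩ => EReal.coe_injective hε ▸ ε.2, fun h => ⟨⟨s, h⟩, rfl⟩⟩

lemma ordConnected_range_scaleEmbedding (r : ℝ) :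
    (Set.range (scaleEmbedding r)).OrdConnected := by
  refine ⟨?_⟩
  rintro _ ⟨s, rfl⟩ _ ⟨t, rfl⟩ x ⟨hsx, hxt⟩
  induction x with
  | bot => exact absurd (le_bot_iff.1 hsx) (EReal.coe_ne_bot _)
  | coe x => exact coe_mem_range_scaleEmbedding.2 (s.2.trans (EReal.coe_le_coe_iff.1 hsx))
  | top => exact absurd (top_le_iff.1 hxt) (EReal.coe_ne_top _)

variable {𝕜 : Type*} [Field 𝕜]

/-- The extension of a tower of vector spaces by zero to all extended real scales. -/
noncomputable abbrev extendTower (M : Tower r (ModuleCat 𝕜)) : EReal ⥤ ModuleCat 𝕜 :=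
  extendByZero (ordConnected_range_scaleEmbedding r) M

/-- The rank function of a tower of vector spaces that is extended by zero to the extended reals. -/
noncomputable abbrev towerRank (M : Tower r (ModuleCat 𝕜)) : EReal → EReal → ℕ :=
  morphismRank (𝟙 (extendTower M))

variable (M : Tower r (ModuleCat 𝕜))

lemma isZero_extendTower_bot : Limits.IsZero ((extendTower M).obj ⊥) :=
  isZero_extendObj fun ⟨_, h⟩ => EReal.coe_ne_bot _ h

lemma isZero_extendTower_top : Limits.IsZero ((extendTower M).obj ⊤) :=
  isZero_extendObj fun ⟨_, h⟩ => EReal.coe_ne_top _ h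

lemma towerRank_coe_coe (s t : ℝ) : towerRank M s t = persistentRank M s t := by
  rw [persistentRank]
  split_ifs with h
  · exact morphismRank_extendByZero _ M (j := ⟨s, h.1⟩) (k := ⟨t, h.1.trans h.2⟩) h.2
  · rcases not_and_or.1 h with h | h
    · exact morphismRank_of_isZero_left _
        (isZero_extendObj (mt coe_mem_range_scaleEmbedding.1 h)) _
    · exact dif_neg (mt EReal.coe_le_coe_iff.1 h)

lemma towerRank_coe_of_lt (s : ℝ) {t : EReal} (h : s < t) :
    towerRank M s t = persistentRankE M s t := by
  rw [persistentRankE]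
  split_ifs with ht
  · rw [ht]
    exact morphismRank_of_isZero_right _ _ (isZero_extendTower_top M)
  · lift t to ℝ using ⟨ht, h.ne_bot⟩
    exact towerRank_coe_coe M s t

lemma towerRank_of_lt {s : EReal} (h : s < r) (t : EReal) : towerRank M s t = 0 := by
  refine morphismRank_of_isZero_left _ (isZero_extendObj ?_) t
  rintro ⟨ε, rfl⟩
  exact h.not_ge (EReal.coe_le_coe_iff.2 ε.2)

lemma boxCount_towerRank {a b c : ℝ} {d : EReal} (hab : a < b) (hbd : b < d) :
    boxCount (towerRank M) a b c d = boxMultiplicity M a b c d := by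
  rw [boxCount, boxMultiplicity, towerRank_coe_coe, towerRank_coe_coe,
    towerRank_coe_of_lt M b hbd,
    towerRank_coe_of_lt M a ((EReal.coe_lt_coe_iff.2 hab).trans hbd)]

lemma exists_coe_boxCount_eq {a : EReal} {b' : ℝ} (ha : WayBelow a (b' : EReal)) :
    ∃ a' : ℝ, a' < b' ∧
      ∀ b c d, boxCount (towerRank M) a' b c d = boxCount (towerRank M) a b c d := by
  have ha' : a < b' := ha.elim id fun h => h ▸ EReal.bot_lt_coe b'
  induction a with
  | bot =>
    have below_start : ((min r b' - 1 : ℝ) : EReal) < r :=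
      EReal.coe_lt_coe_iff.2 (by linarith [min_le_left r b'])
    refine ⟨min r b' - 1, by linarith [min_le_right r b'], fun b c d => ?_⟩
    simp only [boxCount, towerRank_of_lt M below_start, towerRank_of_lt M (EReal.bot_lt_coe r)]
  | coe a => exact ⟨a, EReal.coe_lt_coe_iff.1 ha', fun _ _ _ => rfl⟩
  | top => exact absurd ha' not_top_lt

lemma pointMultiplicity_towerRank (p : DiagramPoint) :
    pointMultiplicity (towerRank M) p.1.1 p.1.2 = persistenceDiagram M p := by
  have wayAbove_iff (d : EReal) : WayAbove d p.1.2 ↔ p.1.2 < d ∨ p.1.2 = ⊤ ∧ d = ⊤ := by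
    refine ⟨?_, Or.imp_right And.right⟩
    rintro (h | rfl)
    · exact Or.inl h
    · exact (eq_top_or_lt_top p.1.2).symm.imp_right fun h => ⟨h, rfl⟩
  unfold pointMultiplicity persistenceDiagram
  congr 1
  ext n
  constructor
  · rintro ⟨a, b, c, d, ha, hb, hbc, hc, hd, hn⟩
    lift b to ℝ using ⟨(hbc.trans hc).ne_top, hb.ne_bot⟩
    lift c to ℝ using ⟨hc.ne_top, hbc.ne_bot⟩
    obtain ⟨a, ha, boxCount_eq⟩ := exists_coe_boxCount_eq M ha
    have hbd := (hbc.trans hc).trans_le hd.le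
    rw [← boxCount_eq, boxCount_towerRank M (ha.trans (EReal.coe_lt_coe_iff.1 hb)) hbd] at hn
    exact ⟨a, b, c, d, ha, EReal.coe_lt_coe_iff.1 hb, EReal.coe_lt_coe_iff.1 hbc, hc,
      (wayAbove_iff d).1 hd, hn⟩
  · rintro ⟨a, b, c, d, ha, hb, hbc, hc, hd, hn⟩
    rw [← wayAbove_iff] at hd
    have hbc' := EReal.coe_lt_coe_iff.2 hbc
    rw [← boxCount_towerRank M (ha.trans hb) ((hbc'.trans hc).trans_le hd.le)] at hn
    exact ⟨a, b, c, d, Or.inl (EReal.coe_lt_coe_iff.2 ha), EReal.coe_lt_coe_iff.2 hb, hbc', hc, hd,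
      hn⟩

lemma pointMultiplicity_towerRank_bot {d : EReal} (hd : ⊥ < d) :
    pointMultiplicity (towerRank M) ⊥ d = 0 := by
  obtain ⟨c, hc, hcd⟩ := exists_between (lt_min hd (EReal.bot_lt_coe r))
  obtain ⟨b, hb, hbc⟩ := exists_between hc
  refine Nat.sInf_eq_zero.2 (Or.inl ⟨⊥, b, c, ⊤, wayBelow_bot, hb, hbc,
    hcd.trans_le (min_le_left _ _), Or.inr rfl, ?_⟩)
  have below_start := (hbc.trans hcd).trans_le (min_le_right _ _)
  simp only [boxCount, towerRank_of_lt M below_start, towerRank_of_lt M (EReal.bot_lt_coe r)]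
  rfl

lemma exists_point_equiv : ∃ F : (persistenceDiagram M).Point ≃ RankPoint (towerRank M),
    ∀ x, (F x).birth = x.1.1.1 ∧ (F x).death = x.1.1.2 := by
  let toEReal (p : DiagramPoint) : {p : EReal × EReal // p.1 < p.2} := ⟨(p.1.1, p.1.2), p.2⟩
  have toEReal_injective : Function.Injective toEReal := fun p q h =>
    Subtype.ext (Prod.ext (EReal.coe_injective (congrArg (·.1.1) h)) (congrArg (·.1.2) h))
  let F : (persistenceDiagram M).Point → RankPoint (towerRank M) :=
    Sigma.map toEReal fun p => finCongr (pointMultiplicity_towerRank M p).symm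
  refine ⟨Equiv.ofBijective F ⟨toEReal_injective.sigma_map fun p => (finCongr _).injective, ?_⟩,
    fun x => ⟨rfl, rfl⟩⟩
  rintro ⟨⟨⟨b, d⟩, hbd⟩, i⟩
  induction b with
  | bot => exact ((Nat.not_lt_zero _) (i.2.trans_eq (pointMultiplicity_towerRank_bot M hbd))).elim
  | coe b => exact ⟨⟨⟨(b, d), hbd⟩, finCongr (pointMultiplicity_towerRank M ⟨(b, d), hbd⟩) i⟩, rfl⟩
  | top => exact (not_top_lt hbd).elim

lemma mem_map_symm_iff {A B : Type*} (e : A ≃ B) (o : Option B) (a : A) :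
    a ∈ o.map e.symm ↔ e a ∈ o := by
  simp [e.symm_apply_eq]

lemma exists_pequiv_of_equiv {A A' B B' : Type*} (F : A ≃ A') (G : B ≃ B') (P : A' ≃. B') :
    ∃ Q : A ≃. B, (∀ x y, y ∈ Q x → G y ∈ P (F x)) ∧ (∀ x, Q x = none → P (F x) = none) ∧
      ∀ y, Q.symm y = none → P.symm (G y) = none :=
  ⟨⟨fun x => (P (F x)).map G.symm, fun y => (P.symm (G y)).map F.symm, fun x y =>
      (mem_map_symm_iff F _ x).trans (P.mem_iff_mem.trans (mem_map_symm_iff G _ y).symm)⟩,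
    fun _ y => (mem_map_symm_iff G _ y).1, fun _ => Option.map_eq_none_iff.1,
    fun _ => Option.map_eq_none_iff.1⟩

lemma close_of_le {η : ℝ≥0} {p q : DiagramPoint}
    (hb : (q.1.1 : EReal) ≤ p.1.1 + (η : ℝ) ∧ (p.1.1 : EReal) ≤ q.1.1 + (η : ℝ))
    (hd : q.1.2 ≤ p.1.2 + (η : ℝ) ∧ p.1.2 ≤ q.1.2 + (η : ℝ)) :
    PersistenceDiagram.Close η p q := by
  rw [← EReal.coe_add, ← EReal.coe_add, EReal.coe_le_coe_iff, EReal.coe_le_coe_iff] at hb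
  exact ⟨abs_sub_le_iff.2 ⟨by linarith, by linarith⟩, hd.symm⟩

lemma nearDiagonal_of_le {η : ℝ≥0} {p : DiagramPoint} (h : p.1.2 ≤ p.1.1 + (η : ℝ) + (η : ℝ)) :
    PersistenceDiagram.NearDiagonal η p := by
  rwa [add_assoc, ← EReal.coe_add, ← EReal.coe_add, ← two_mul] at h

namespace Interleaving

variable {η : ℝ≥0} {M N : Tower r (ModuleCat 𝕜)} [∀ ε, Module.Finite 𝕜 (M.obj ε)]
  [∀ ε, Module.Finite 𝕜 (N.obj ε)]

theorem hasMatching (I : Interleaving (fun _ _ => shift_mono η) (le_shift η) M N) :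
    (persistenceDiagram M).HasMatching (persistenceDiagram N) η := by
  obtain ⟨F, hF⟩ := exists_point_equiv M
  obtain ⟨G, hG⟩ := exists_point_equiv N
  have I' := I.extendByZero (ordConnected_range_scaleEmbedding r) (fun _ _ => shift_mono η)
    (e := erealAddRight η) (fun _ => le_add_of_nonneg_right (EReal.coe_nonneg.2 η.2))
    fun ε => EReal.coe_add ε η
  obtain ⟨P, matched, unmatched_left, unmatched_right⟩ :=
    I'.exists_matching (e := erealAddRight η) (isZero_extendTower_bot M)
      (isZero_extendTower_top M) (isZero_extendTower_bot N) (isZero_extendTower_top N)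
  obtain ⟨Q, mem, none_left, none_right⟩ := exists_pequiv_of_equiv F G P
  refine ⟨Q, fun x y hxy => ?_, fun x hx => nearDiagonal_of_le ?_,
    fun y hy => nearDiagonal_of_le ?_⟩
  · have h := matched _ _ (mem x y hxy)
    rw [(hF x).1, (hF x).2, (hG y).1, (hG y).2] at h
    exact close_of_le h.1 h.2
  · have h := unmatched_left _ (none_left x hx)
    rwa [(hF x).1, (hF x).2] at h
  · have h := unmatched_right _ (none_right y hy)
    rwa [(hG y).1, (hG y).2] at h

theorem bottleneckDist_le (I : Interleaving (fun _ _ => shift_mono η) (le_shift η) M N) :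
    (persistenceDiagram M).bottleneckDist (persistenceDiagram N) ≤ η :=
  iInf₂_le η I.hasMatching

end Interleaving

end RealTower

/-! ### Simplicial homology -/

section SimplicialHomology

open MonoidalCategory Simplicial

universe u₁ u₀

/-- The homotopy between contiguous simplicial maps that applies `f` to the vertices over `0` and
`g` to those over `1`. -/
noncomputable def SimplicialMap.Contiguous.homotopy {K L : FinComplex.{u₁}} {f g : K ⟶ L}
    (h : SimplicialMap.Contiguous f g) :
    SSet.Homotopy (orderedSimplices.map f) (orderedSimplices.map g) where
  h :=
    { app := fun n => ↾fun p => ⟨fun j =>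
        if SSet.stdSimplex.asOrderHom p.2 j = 0 then SimplicialMap.toFun f (p.1.1 j)
          else SimplicialMap.toFun g (p.1.1 j), by
        classical
        refine (L.complex.isRelLowerSet_faces (h _ p.1.2)).2 ?_ (Finset.univ_nonempty.image _)
        intro v hv
        obtain ⟨j, -, rfl⟩ := Finset.mem_image.1 hv
        simp only [Finset.mem_union, Finset.mem_image, Finset.mem_univ, true_and]
        split_ifs
        · exact Or.inl ⟨_, ⟨j, rfl⟩, rfl⟩
        · exact Or.inr ⟨_, ⟨j, rfl⟩, rfl⟩⟩
      naturality := fun _ _ _ => rfl }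
  h₀ := rfl
  h₁ := rfl
  rel := by
    ext n ⟨⟨x, hx⟩, y⟩
    exact hx.elim

variable (𝕜 : Type u₀) [Field 𝕜] (k : ℕ)

lemma SimplicialMap.Contiguous.simplicialHomology_map_eq {K L : FinComplex.{u₁}} {f g : K ⟶ L}
    (h : SimplicialMap.Contiguous f g) :
    (simplicialHomology 𝕜 k).map f = (simplicialHomology 𝕜 k).map g :=
  h.homotopy.congr_homologyMap _ k

lemma finite_homology {R : Type u₀} [Ring R] [IsNoetherianRing R]
    (S : ShortComplex (ModuleCat.{u₁} R)) [Module.Finite R S.X₂] : Module.Finite R S.homology := by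
  have : Module.Finite R S.cycles :=
    Module.Finite.of_injective S.iCycles.hom ((ModuleCat.mono_iff_injective _).1 inferInstance)
  exact Module.Finite.of_surjective S.homologyπ.hom
    ((ModuleCat.epi_iff_surjective _).1 inferInstance)

instance finite_orderedSimplices (K : FinComplex.{u₁}) (n) :
    Finite ((orderedSimplices.obj K).obj n) :=
  have := K.finite
  inferInstanceAs (Finite {_s : Fin (n.unop.len + 1) → K.V // _})

lemma finite_simplicialHomology (K : FinComplex.{u₁}) :
    Module.Finite 𝕜 ((simplicialHomology 𝕜 k).obj K) := by
  classical
  let X := orderedSimplices.obj K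
  have : Module.Finite 𝕜 (Π₀ _ : X.obj (.op (.mk k)), ULift.{u₁} 𝕜) := inferInstance
  have : Module.Finite 𝕜 ((X.chainComplex (ModuleCat.of 𝕜 (ULift.{u₁} 𝕜))).sc k).X₂ :=
    Module.Finite.equiv (ModuleCat.coprodIsoDirectSum
      fun _ : X.obj (.op (.mk k)) => ModuleCat.of 𝕜 (ULift.{u₁} 𝕜)).symm.toLinearEquiv
  exact finite_homology _

end SimplicialHomology

section ChainComparison

open Limits

universe u₂ u₁

variable {C D : Type*} [Category* C] [Category* D] [HasCoproducts.{u₁} C]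
  [HasCoproducts.{max u₁ u₂} D] (F : C ⥤ D) {R : C} {R' : D} (i : R' ≅ F.obj R)

/-- The comparison of a coproduct of copies of `R'`, which is isomorphic to `F R`, over a set in a
larger universe with the image under `F` of a coproduct of copies of `R`. -/
noncomputable def sigmaULiftComparison (T : Type u₁) :
    (∐ fun _ : ULift.{u₂} T => R') ⟶ F.obj (∐ fun _ : T => R) :=
  Sigma.desc fun x => i.hom ≫ F.map (Sigma.ι (fun _ : T => R) x.down)

lemma ι_sigmaULiftComparison {T : Type u₁} (x : ULift.{u₂} T) :
    Sigma.ι (fun _ => R') x ≫ sigmaULiftComparison F i T =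
      i.hom ≫ F.map (Sigma.ι (fun _ => R) x.down) :=
  Sigma.ι_desc _ _

lemma isIso_sigmaULiftComparison (T : Type u₁)
    [PreservesColimit (Discrete.functor fun _ : T => R) F] :
    IsIso (sigmaULiftComparison.{u₂} F i T) := by
  have := hasCoproducts_shrink.{u₁, max u₁ u₂} (C := D)
  have factorization : sigmaULiftComparison.{u₂} F i T =
      (Sigma.whiskerEquiv Equiv.ulift.{u₂} fun _ => i.symm).hom ≫
        sigmaComparison F fun _ : T => R := by
    refine Sigma.hom_ext _ _ fun x => ?_
    simp [Sigma.whiskerEquiv, ι_sigmaULiftComparison]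
  rw [factorization]
  infer_instance

lemma map_comp_sigmaULiftComparison {T T' : Type u₁} (f : T → T') :
    Sigma.map' (ULift.map f) (fun _ => 𝟙 R') ≫ sigmaULiftComparison.{u₂} F i T' =
      sigmaULiftComparison.{u₂} F i T ≫ F.map (Sigma.map' f fun _ => 𝟙 R) := by
  refine Sigma.hom_ext _ _ fun ⟨x⟩ => ?_
  calc
    _ = Sigma.ι (fun _ => R') (ULift.up (f x)) ≫ sigmaULiftComparison.{u₂} F i T' := by simp
    _ = (Sigma.ι (fun _ => R') ⟨x⟩ ≫ sigmaULiftComparison.{u₂} F i T) ≫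
        F.map (Sigma.map' f fun _ => 𝟙 R) := by
      rw [ι_sigmaULiftComparison, ι_sigmaULiftComparison, Category.assoc, ← F.map_comp]
      simp
    _ = _ := Category.assoc _ _ _

/-- The comparison of coproducts of copies, as a natural transformation. -/
noncomputable def sigmaConstComparison :
    CategoryTheory.uliftFunctor.{u₂, u₁} ⋙ sigmaConst.obj R' ⟶ sigmaConst.obj R ⋙ F where
  app := sigmaULiftComparison F i
  naturality _ _ f := map_comp_sigmaULiftComparison F i f

variable [Preadditive C] [Preadditive D] [F.Additive]

/-- The comparison of the chain complexes of a simplicial set in two universes. -/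
noncomputable def chainComplexComparison :
    SSet.uliftFunctor.{u₂, u₁} ⋙ (SSet.chainComplexFunctor D).obj R' ⟶
      (SSet.chainComplexFunctor C).obj R ⋙ F.mapHomologicalComplex _ :=
  Functor.whiskerRight ((SimplicialObject.whiskering _ _).map (sigmaConstComparison.{u₂} F i))
      (AlgebraicTopology.alternatingFaceMapComplex D) ≫
    Functor.whiskerLeft ((SimplicialObject.whiskering _ _).obj (sigmaConst.obj R))
      (eqToHom (AlgebraicTopology.map_alternatingFaceMapComplex F).symm)

lemma isIso_chainComplexComparison_app [PreservesFiniteCoproducts F] (X : SSet.{u₁})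
    [∀ n, Finite (X.obj n)] : IsIso ((chainComplexComparison.{u₂} F i).app X) := by
  let c := ((SimplicialObject.whiskering _ _).map (sigmaConstComparison.{u₂} F i)).app X
  have isIso_app (n) : IsIso (c.app n) := isIso_sigmaULiftComparison F i (X.obj n)
  have := NatIso.isIso_of_isIso_app c
  let e := (eqToIso (AlgebraicTopology.map_alternatingFaceMapComplex F).symm).app
    (((SimplicialObject.whiskering _ _).obj (sigmaConst.obj R)).obj X)
  exact IsIso.comp_isIso' (Functor.map_isIso (AlgebraicTopology.alternatingFaceMapComplex D) c)
    e.isIso_hom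

end ChainComparison

section Universe

universe u₂ u₁ u₀

variable (𝕜 : Type u₀) [Field 𝕜] (k : ℕ)

/-- The coefficients in a larger universe. -/
def uliftCoeff : ModuleCat.of 𝕜 (ULift.{max u₁ u₂} 𝕜) ≅
    (ModuleCat.uliftFunctor.{u₂, max u₁ u₀} 𝕜).obj (ModuleCat.of 𝕜 (ULift.{u₁} 𝕜)) :=
  (ULift.moduleEquiv.trans (ULift.moduleEquiv.symm.trans ULift.moduleEquiv.symm)).toModuleIso

lemma homRank_homologyMap_uliftFunctor {X Y : SSet.{u₁}} [∀ n, Finite (X.obj n)]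
    [∀ n, Finite (Y.obj n)] (f : X ⟶ Y) :
    homRank (SSet.homologyMap (SSet.uliftFunctor.{u₂, u₁}.map f)
      (ModuleCat.of 𝕜 (ULift.{max u₁ u₂} 𝕜)) k) =
    homRank (SSet.homologyMap f (ModuleCat.of 𝕜 (ULift.{u₁} 𝕜)) k) := by
  let F := ModuleCat.uliftFunctor.{u₂, max u₁ u₀} 𝕜
  let c := chainComplexComparison.{u₂, u₁} F (uliftCoeff 𝕜)
  have := isIso_chainComplexComparison_app.{u₂, u₁} F (uliftCoeff 𝕜) X
  have := isIso_chainComplexComparison_app.{u₂, u₁} F (uliftCoeff 𝕜) Y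
  let f' := SSet.chainComplexMap f (ModuleCat.of 𝕜 (ULift.{u₁} 𝕜))
  have comparison_square := congrArg (HomologicalComplex.homologyMap · k) (c.naturality f)
  simp only [HomologicalComplex.homologyMap_comp] at comparison_square
  calc
    _ = homRank (HomologicalComplex.homologyMap ((F.mapHomologicalComplex _).map f') k) :=
      homRank_eq_of_iso (asIso (HomologicalComplex.homologyMap (c.app X) k))
        (asIso (HomologicalComplex.homologyMap (c.app Y) k)) comparison_square
    _ = homRank (F.map (HomologicalComplex.homologyMap f' k)) :=
      homRank_eq_of_iso _ _ (ShortComplex.mapHomologyIso_hom_naturality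
        ((HomologicalComplex.shortComplexFunctor _ _ k).map f') F)
    _ = _ := homRank_uliftFunctor_map _

/-- A finite simplicial complex in a larger universe. -/
def FinComplex.ulift (K : FinComplex.{u₁}) : FinComplex.{max u₁ u₂} where
  V := ULift.{u₂} K.V
  finite := have := K.finite; inferInstance
  complex :=
    { faces := {σ | σ.map Equiv.ulift.toEmbedding ∈ K.complex.faces}
      isRelLowerSet_faces := fun _ hσ =>
        ⟨Finset.map_nonempty.1 (K.complex.isRelLowerSet_faces hσ).1, fun _ hτ hne =>
          (K.complex.isRelLowerSet_faces hσ).2 (Finset.map_subset_map.2 hτ) hne.map⟩ }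

/-- The vertex of `K` underlying a vertex of `K.ulift`. -/
def FinComplex.down {K : FinComplex.{u₁}} (v : (FinComplex.ulift.{u₂} K).V) : K.V :=
  ULift.down v

/-- The vertex of `K.ulift` given by a vertex of `K`. -/
def FinComplex.up {K : FinComplex.{u₁}} (v : K.V) : (FinComplex.ulift.{u₂} K).V :=
  ULift.up v

open scoped Classical in
lemma FinComplex.mem_ulift {K : FinComplex.{u₁}} {σ : Finset (FinComplex.ulift.{u₂} K).V} :
    σ ∈ (FinComplex.ulift.{u₂} K).complex.faces ↔ σ.image FinComplex.down ∈ K.complex.faces :=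
  iff_of_eq (congrArg (· ∈ K.complex.faces) (Finset.map_eq_image _ _))

open scoped Classical in
lemma FinComplex.image_mem_ulift {K : FinComplex.{u₁}} {ι : Type*} {σ : Finset ι}
    {f : ι → (FinComplex.ulift.{u₂} K).V} :
    σ.image f ∈ (FinComplex.ulift.{u₂} K).complex.faces ↔
      σ.image (fun i => FinComplex.down (f i)) ∈ K.complex.faces := by
  rw [FinComplex.mem_ulift, Finset.image_image]
  rfl

universe u₃ u₄

/-- A simplicial map in a larger universe. -/
def SimplicialMap.ulift {K : FinComplex.{u₁}} {L : FinComplex.{u₂}} (f : SimplicialMap K L) :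
    SimplicialMap (FinComplex.ulift.{u₃} K) (FinComplex.ulift.{u₄} L) where
  toFun v := FinComplex.up (f.toFun (FinComplex.down v))
  image_mem σ hσ := by
    classical
    have h := f.image_mem _ (FinComplex.mem_ulift.1 hσ)
    rw [Finset.image_image] at h
    exact FinComplex.image_mem_ulift.2 h

lemma SimplicialMap.Contiguous.ulift {K : FinComplex.{u₁}} {L : FinComplex.{u₂}}
    {f g : SimplicialMap K L} (h : f.Contiguous g) :
    (SimplicialMap.ulift.{u₂, u₁, u₃, u₄} f).Contiguous
      (SimplicialMap.ulift.{u₂, u₁, u₃, u₄} g) := by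
  classical
  intro σ hσ
  have h := h _ (FinComplex.mem_ulift.1 hσ)
  rw [Finset.image_image, Finset.image_image] at h
  rw [FinComplex.mem_ulift, Finset.image_union, Finset.image_image, Finset.image_image]
  exact h

/-- The functor to finite simplicial complexes in a larger universe. -/
def FinComplex.uliftFunctor : FinComplex.{u₁} ⥤ FinComplex.{max u₁ u₂} where
  obj K := FinComplex.ulift.{u₂} K
  map f := SimplicialMap.ulift.{u₁, u₁, u₂, u₂} f

/-- The ordered simplices of a complex in a larger universe. -/
def orderedSimplicesULift : FinComplex.uliftFunctor.{u₂, u₁} ⋙ orderedSimplices ≅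
    orderedSimplices ⋙ SSet.uliftFunctor.{u₂, u₁} :=
  NatIso.ofComponents fun K =>
    { hom.app := fun n => ↾fun s => ULift.up ⟨fun i => FinComplex.down (s.1 i),
        FinComplex.image_mem_ulift.1 s.2⟩
      inv.app := fun n => ↾fun s => ⟨fun i => FinComplex.up (ULift.down s |>.1 i),
        FinComplex.image_mem_ulift.2 (ULift.down s).2⟩ }

lemma homRank_simplicialHomology_ulift {K L : FinComplex.{u₁}} (f : K ⟶ L) :
    homRank ((simplicialHomology 𝕜 k).map (FinComplex.uliftFunctor.{u₂}.map f)) =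
      homRank ((simplicialHomology 𝕜 k).map f) := by
  let H := SSet.homologyFunctor.{max u₁ u₂} (ModuleCat.of 𝕜 (ULift.{max u₁ u₂} 𝕜)) k
  let i := Functor.isoWhiskerRight orderedSimplicesULift.{u₂, u₁} H
  exact (homRank_eq_of_iso (i.app K) (i.app L) (i.hom.naturality f)).trans
    (homRank_homologyMap_uliftFunctor 𝕜 k (orderedSimplices.map f))

lemma simplicialPersistenceDiagram_ulift {r : ℝ} (S : Tower r FinComplex.{u₁}) :
    simplicialPersistenceDiagram 𝕜 k (S ⋙ FinComplex.uliftFunctor.{u₂}) =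
      simplicialPersistenceDiagram 𝕜 k S := by
  have persistentRank_eq :
      persistentRank ((S ⋙ FinComplex.uliftFunctor.{u₂}) ⋙ simplicialHomology 𝕜 k) =
        persistentRank (S ⋙ simplicialHomology 𝕜 k) := by
    funext s t
    unfold persistentRank
    split_ifs with h
    · exact homRank_simplicialHomology_ulift 𝕜 k _
    · rfl
  funext p
  simp only [simplicialPersistenceDiagram, persistenceDiagram, boxMultiplicity, persistentRankE,
    persistentRank_eq]

end Universe

/-! ### Stability -/

section Stability

universe u₁ u₂ u₀

variable {r : ℝ} {η : ℝ≥0}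

lemma SimplicialInterleaved.ulift {S : Tower r FinComplex.{u₁}} {T : Tower r FinComplex.{u₂}}
    (h : SimplicialInterleaved η S T) :
    SimplicialInterleaved η (S ⋙ FinComplex.uliftFunctor.{u₂})
      (T ⋙ FinComplex.uliftFunctor.{u₁}) := by
  obtain ⟨φ, ψ, hφψ, hψφ, hφ, hψ⟩ := h
  exact ⟨fun ε => (φ ε).ulift, fun ε => (ψ ε).ulift, fun ε => (hφψ ε).ulift,
    fun ε => (hψφ ε).ulift, fun _ _ h => (hφ _ _ h).ulift, fun _ _ h => (hψ _ _ h).ulift⟩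

variable (𝕜 : Type u₀) [Field 𝕜] (k : ℕ)

lemma SimplicialInterleaved.nonempty_interleaving {S T : Tower r FinComplex.{u₁}}
    (h : SimplicialInterleaved η S T) :
    Nonempty (Interleaving (fun _ _ => shift_mono η) (le_shift η)
      (S ⋙ simplicialHomology 𝕜 k) (T ⋙ simplicialHomology 𝕜 k)) := by
  obtain ⟨φ, ψ, hφψ, hψφ, hφ, hψ⟩ := h
  let H := simplicialHomology.{u₁} 𝕜 k
  have comp_eq {K L L' P : FinComplex.{u₁}} {f : K ⟶ L} {g : L ⟶ P} {f' : K ⟶ L'} {g' : L' ⟶ P}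
      (h : SimplicialMap.Contiguous (f ≫ g) (f' ≫ g')) :
      H.map f ≫ H.map g = H.map f' ≫ H.map g' := by
    exact (H.map_comp f g).symm.trans ((h.simplicialHomology_map_eq 𝕜 k).trans (H.map_comp f' g'))
  exact ⟨{
    hom := fun ε => H.map (φ ε)
    inv := fun ε => H.map (ψ ε)
    hom_naturality := fun h => comp_eq (hφ _ _ h)
    inv_naturality := fun h => (comp_eq (hψ _ _ h)).symm
    hom_inv := fun ε => (H.map_comp _ _).symm.trans ((hφψ ε).simplicialHomology_map_eq 𝕜 k)
    inv_hom := fun ε => (H.map_comp _ _).symm.trans ((hψφ ε).simplicialHomology_map_eq 𝕜 k) }⟩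

theorem SimplicialInterleaved.bottleneckDist_le {S : Tower r FinComplex.{u₁}}
    {T : Tower r FinComplex.{u₂}} (h : SimplicialInterleaved η S T) :
    (simplicialPersistenceDiagram 𝕜 k S).bottleneckDist (simplicialPersistenceDiagram 𝕜 k T) ≤
      η := by
  obtain ⟨I⟩ := h.ulift.nonempty_interleaving 𝕜 k
  rw [← simplicialPersistenceDiagram_ulift.{u₂} 𝕜 k S,
    ← simplicialPersistenceDiagram_ulift.{u₁} 𝕜 k T]
  have finite_left (ε) : Module.Finite 𝕜
      (((S ⋙ FinComplex.uliftFunctor.{u₂}) ⋙ simplicialHomology 𝕜 k).obj ε) :=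
    finite_simplicialHomology 𝕜 k _
  have finite_right (ε) : Module.Finite 𝕜
      (((T ⋙ FinComplex.uliftFunctor.{u₁}) ⋙ simplicialHomology 𝕜 k).obj ε) :=
    finite_simplicialHomology 𝕜 k _
  exact I.bottleneckDist_le

end Stability

section MultiscaleMapper

universe u₁ u₂ u₃ u₄

/-- The simplicial map of nerves induced by a map of covers whose index sets may lie in different
universes. -/
def CoverMap.nerveMap {X : Type u₃} {U : Cover.{u₁, u₃} X} {V : Cover.{u₂, u₃} X}
    (φ : CoverMap U V) : SimplicialMap U.nerve V.nerve where
  toFun := φ.toFun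
  image_mem := by
    classical
    rintro σ ⟨hσ, x, hx⟩
    refine ⟨hσ.image _, x, ?_⟩
    simp only [Set.mem_iInter] at hx ⊢
    intro j hj
    obtain ⟨i, hi, rfl⟩ := Finset.mem_image.1 hj
    exact φ.subset i (hx i hi)

lemma CoverMap.contiguous {X : Type u₃} {U : Cover.{u₁, u₃} X} {V : Cover.{u₂, u₃} X}
    (φ ψ : CoverMap U V) : φ.nerveMap.Contiguous ψ.nerveMap := by
  classical
  rintro σ ⟨hσ, x, hx⟩
  refine ⟨(hσ.image _).mono Finset.subset_union_left, x, ?_⟩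
  simp only [Set.mem_iInter] at hx ⊢
  intro j hj
  rcases Finset.mem_union.1 hj with hj | hj
  · obtain ⟨i, hi, rfl⟩ := Finset.mem_image.1 hj
    exact φ.subset i (hx i hi)
  · obtain ⟨i, hi, rfl⟩ := Finset.mem_image.1 hj
    exact ψ.subset i (hx i hi)

variable {X : Type u₃} {Z : Type u₄} [TopologicalSpace X] [TopologicalSpace Z]

/-- The map of pullback covers induced by a map of covers whose index sets may lie in different
universes. -/
def CoverMap.pullback (f : C(X, Z)) (hf : WellBehaved f) {U : OpenCover.{u₁, u₄} Z}
    {V : OpenCover.{u₂, u₄} Z} (φ : CoverMap U.toCover V.toCover) :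
    CoverMap (U.pullback f hf) (V.pullback f hf) where
  toFun p := ⟨φ.toFun p.1, pathComponentMap (Set.preimage_mono (φ.subset p.1)) p.2⟩
  subset := by
    rintro ⟨i, c⟩ _ ⟨x, hx, rfl⟩
    exact ⟨Set.inclusion (Set.preimage_mono (φ.subset i)) x,
      congrArg (pathComponentMap (Set.preimage_mono (φ.subset i))) hx, rfl⟩

theorem CoverInterleaved.multiscaleMapper {r : ℝ} {η : ℝ≥0} {U : Tower r (OpenCover.{u₁, u₄} Z)}
    {V : Tower r (OpenCover.{u₂, u₄} Z)} (h : CoverInterleaved η U V) (f : C(X, Z))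
    (hf : WellBehaved f) :
    SimplicialInterleaved η (multiscaleMapper U f hf) (multiscaleMapper V f hf) := by
  let φ ε := (h.1 ε).some.pullback f hf
  let ψ ε := (h.2 ε).some.pullback f hf
  let u {ε ε' : Set.Ici r} (h : ε ≤ ε') := CoverMap.pullback f hf (U.map (homOfLE h))
  let v {ε ε' : Set.Ici r} (h : ε ≤ ε') := CoverMap.pullback f hf (V.map (homOfLE h))
  exact ⟨fun ε => (φ ε).nerveMap, fun ε => (ψ ε).nerveMap,
    fun ε => CoverMap.contiguous ((φ ε).comp (ψ _)) (u _),
    fun ε => CoverMap.contiguous ((ψ ε).comp (φ _)) (v _),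
    fun _ _ h => CoverMap.contiguous ((u h).comp (φ _)) ((φ _).comp (v (shift_mono η h))),
    fun _ _ h => CoverMap.contiguous ((ψ _).comp (u (shift_mono η h))) ((v h).comp (ψ _))⟩

end MultiscaleMapper

theorem mainTheorem6 {X : Type u} {Z : Type v}
    [TopologicalSpace X] [TopologicalSpace Z] (𝕜 : Type t) [Field 𝕜]
    (η : ℝ≥0) (r : ℝ) (hr : 0 < r)
    (U : Tower r (OpenCover.{w, v} Z)) (V : Tower r (OpenCover.{w', v} Z))
    (f : C(X, Z)) (hf : WellBehaved f) (hUV : CoverInterleaved η U V) :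
    SimplicialInterleaved η (multiscaleMapper U f hf) (multiscaleMapper V f hf) ∧
    ∀ k : ℕ, PersistenceDiagram.bottleneckDist
      (simplicialPersistenceDiagram 𝕜 k (multiscaleMapper U f hf))
      (simplicialPersistenceDiagram 𝕜 k (multiscaleMapper V f hf)) ≤ (η : ℝ≥0∞) := by
  exact ⟨hUV.multiscaleMapper f hf, fun k => (hUV.multiscaleMapper f hf).bottleneckDist_le 𝕜 k⟩
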